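/- For parameters in $[0,1]$ consider the input-output process with input and output alphabets $\{0,1,2\}$ whose $\epsilon$-transducer has three causal states $f,e,u$ and the following transitions ("$y|x:p$" means: on input $x$, with probability $p$, output $y$ and move to the indicated state). From $f$: $0|0:p_1$ and $0|1:q_1$ to $u$; $1|0:1-p_1$, $1|1:1-q_1$ and $2|2:1$ to $e$. From $e$: $0|0:p_3$ and $0|1:q_3$ to $f$; $1|0:1-p_3$, $1|1:1-q_3$ and $2|2:1$ to $e$. From $u$: $1|0:p_2$, $1|1:q_2$ and $2|2:1$ to $e$; $0|0:1-p_2$ and $0|1:1-q_2$ to $u$. Let $\mathcal A=\mathcal A_{q_1}$ be the member of this family with $p_1=p_2=0$, $p_3=\tfrac47$, $q_2=\tfrac35$, $q_3=\tfrac1{100}$. For an IID input $\mathcal I$ let $\pi_{\mathcal I}$ be the stationary distribution over the causal states when $\mathcal A$ is driven by $\mathcal I$, and let $C^{\mathcal A}_{\mathcal I}=-\sum_i\pi_{\mathcal I}(i)\log\pi_{\mathcal I}(i)$. A quantum model of $\mathcal A$ consists of a unit vector $|s_i\rangle$ in a finite-dimensional Hilbert space for each causal state $i$, and a unitary $U$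 on memory $\otimes$ input tape $\otimes$ output tape $\otimes$ ancilla with $$U|s_i\rangle|x\rangle|0\rangle|0\rangle=\sum_{y,j}\sqrt{T^{(y|x)}_{ij}}\,|s_j\rangle|x\rangle|y\rangle|\psi_{i,x,y}\rangle ,$$ where $T^{(y|x)}_{ij}$ is the probability of outputting $y$ and moving to state $j$ on input $x$ in state $i$, and the $|\psi_{i,x,y}\rangle$ are arbitrary unit ("junk") vectors. The optimal quantum complexity $Q^{\mathcal A}_{\mathcal I}$ is the minimum, over all quantum models, of the von Neumann entropy of $\rho=\sum_i\pi_{\mathcal I}(i)\,|s_i\rangle\langle s_i|$. Then there are two IID inputs $\mathcal I_1,\mathcal I_2$ such that for every $q_1\in[0.22,0.54]$ the stationary distributions exist and are unique, the minima defining the quantum complexities are attained, and $$C^{\mathcal A}_{\mathcal I_1}>C^{\mathcal A}_{\mathcal I_2}\qquad\text{and}\qquad Q^{\mathcal A}_{\mathcal I_1}<Q^{\mathcal A}_{\mathcal I_2}.$$ Moreover, for every $q_1\in[0.30,0.54]$ the same holds for the inputs $\mathcal I_1,\mathcal I_2$ in which the letters $0,1,2$ have probabilities $(\tfrac2{10},\tfrac1{10},\tfrac7{10})$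 and $(\tfrac1{10},\tfrac7{10},\tfrac2{10})$, respectively. -/

import Mathlib

open scoped Matrix

/-! ### Input-output processes and their causal states -/

/-- A semi-infinite joint past of inputs and outputs; `z 0` is the most recent pair `(x, y)`,
`z 1` the one before it, and so on. -/
abbrev JointPast (X Y : Type) : Type := ℕ → X × Y

namespace JointPast

/-- The past `z` followed by one more time step, with input `x` and output `y`. -/
def extend {X Y : Type} (z : JointPast X Y) (x : X) (y : Y) : JointPast X Y
  | 0 => (x, y)
  | n + 1 => z n

/-- The past as it was `k` time steps earlier. -/
def drop {X Y : Type} (z : JointPast X Y) (k : ℕ) : JointPast X Y := fun n => z (n + k)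

end JointPast

/-- A stationary causal (anticipation-free) input-output process, given by its conditional output
probabilities: `prob z x y = Pr(Y₀ = y | X₀ = x, joint past = z)`. -/
structure InputOutputProcess (X Y : Type) [Fintype Y] where
  prob : JointPast X Y → X → Y → ℝ
  prob_nonneg : ∀ z x y, 0 ≤ prob z x y
  prob_sum : ∀ z x, ∑ y, prob z x y = 1

namespace InputOutputProcess

variable {X Y : Type} [Fintype Y]

/-- A joint past that the process can produce: each of its outputs had positive probability given
the current input and the past before it. -/
def Admissible (A : InputOutputProcess X Y) (z : JointPast X Y) : Prop :=
  ∀ k, 0 < A.prob (z.drop (k + 1)) (z k).1 (z k).2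

/-- `Pr(Y₀ … Y_{L-1} = y₀ … y_{L-1} | X₀ … X_{L-1} = x₀ … x_{L-1}, joint past = z)` for the
word `[(x₀, y₀), …, (x_{L-1}, y_{L-1})]`. -/
def futureProb (A : InputOutputProcess X Y) : JointPast X Y → List (X × Y) → ℝ
  | _, [] => 1
  | z, (x, y) :: w => A.prob z x y * A.futureProb (z.extend x y) w

/-- Two joint pasts are causally equivalent when the conditional distributions of the future
outputs given the future inputs coincide. -/
def CausallyEquivalent (A : InputOutputProcess X Y) (z z' : JointPast X Y) : Prop :=
  ∀ w, A.futureProb z w = A.futureProb z' w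

/-- `S`, labelled by `ε`, is the set of causal states of `A` (the classes of causally equivalent
joint pasts), and `T x y i j = Pr(Y₀ = y, S₁ = j | X₀ = x, S₀ = i)` are its transition
probabilities: `(X, Y, S, T)` is the ε-transducer of `A`. -/
structure IsEpsilonTransducer (A : InputOutputProcess X Y) {S : Type} [DecidableEq S]
    (ε : JointPast X Y → S) (T : X → Y → Matrix S S ℝ) : Prop where
  surjective : ∀ s, ∃ z, A.Admissible z ∧ ε z = s
  eq_iff : ∀ z z', A.Admissible z → A.Admissible z' → (ε z = ε z' ↔ A.CausallyEquivalent z z')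
  transition : ∀ z, A.Admissible z → ∀ x y j,
    T x y (ε z) j = if ε (z.extend x y) = j then A.prob z x y else 0

end InputOutputProcess

/-! ### The stationary distribution over the causal states -/

section Stationary

variable {X Y S : Type} [Fintype X] [Fintype Y] [Fintype S]

/-- `π` is a stationary distribution over the states when the transducer with transition
probabilities `T` is driven by the IID input with letter distribution `I`. -/
def IsStationaryDistribution (T : X → Y → Matrix S S ℝ) (I : X → ℝ) (π : S → ℝ) : Prop :=
  π ∈ stdSimplex ℝ S ∧ ∀ j, ∑ i, π i * (∑ x, I x * ∑ y, T x y i j) = π j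

/-- `π` is the one and only stationary distribution. -/
def IsTheStationaryDistribution (T : X → Y → Matrix S S ℝ) (I : X → ℝ) (π : S → ℝ) : Prop :=
  ∀ π', IsStationaryDistribution T I π' ↔ π' = π

/-- Shannon entropy `-∑ πᵢ log πᵢ` (natural logarithm). -/
noncomputable def shannonEntropy (π : S → ℝ) : ℝ := ∑ i, Real.negMulLog (π i)

end Stationary

/-! ### Quantum models -/

section Quantum

variable {X Y S : Type} [Fintype X] [Fintype Y] [Fintype S] [DecidableEq X] [DecidableEq Y]

/-- The product vector `|v⟩|x⟩|y⟩|a⟩` of the joint system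
memory ⊗ input tape ⊗ output tape ⊗ ancilla. -/
def registerState {d m : ℕ} (v : Fin d → ℂ) (x : X) (y : Y) (a : Fin m → ℂ) :
    Fin d × X × Y × Fin m → ℂ :=
  fun r => v r.1 * (Pi.single x (1 : ℂ) : X → ℂ) r.2.1 *
    (Pi.single y (1 : ℂ) : Y → ℂ) r.2.2.1 * a r.2.2.2

/-- A (statistically faithful) quantum model of an ε-transducer with transition probabilities `T`:
a pure memory state `|sᵢ⟩` for every causal state, and a unitary `U` with
`U |sᵢ⟩|x⟩|0⟩|0⟩ = ∑_{y,j} √(T x y i j) |sⱼ⟩|x⟩|y⟩|ψ⟩`,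
where `|ψ⟩` (which may depend on `i`, `x`, `y`) is a normalised junk state that is discarded.
The input tape is preserved, the output is read off by measuring the output tape in its
computational basis, and the memory is then in the state of the next causal state.
The dimensions of the memory and of the ancilla are arbitrary. -/
structure QuantumModel (T : X → Y → Matrix S S ℝ) where
  d : ℕ
  m : ℕ
  state : S → Fin d → ℂ
  state_norm : ∀ i, star (state i) ⬝ᵥ state i = 1
  /-- the blank symbol `|0⟩` of the output tape -/
  y₀ : Y
  /-- the initial ancilla state `|0⟩` -/
  a₀ : Fin m
  U : Matrix (Fin d × X × Y × Fin m) (Fin d × X × Y × Fin m) ℂ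
  U_unitary : U ∈ Matrix.unitaryGroup (Fin d × X × Y × Fin m) ℂ
  junk : S → X → Y → Fin m → ℂ
  junk_norm : ∀ i x y, star (junk i x y) ⬝ᵥ junk i x y = 1
  evolution : ∀ i x, U *ᵥ registerState (state i) x y₀ (Pi.single a₀ 1) =
    ∑ y, ∑ j, ((Real.sqrt (T x y i j) : ℝ) : ℂ) • registerState (state j) x y (junk i x y)

/-- The average memory state `ρ = ∑ᵢ πᵢ |sᵢ⟩⟨sᵢ|`. -/
noncomputable def QuantumModel.averageState {T : X → Y → Matrix S S ℝ} (q : QuantumModel T)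
    (π : S → ℝ) : Matrix (Fin q.d) (Fin q.d) ℂ :=
  ∑ i, (π i : ℂ) • Matrix.vecMulVec (q.state i) (star (q.state i))

theorem QuantumModel.averageState_isHermitian {T : X → Y → Matrix S S ℝ} (q : QuantumModel T)
    (π : S → ℝ) : (q.averageState π).IsHermitian := by
  unfold QuantumModel.averageState Matrix.IsHermitian
  rw [Matrix.conjTranspose_sum]
  refine Finset.sum_congr rfl fun i _ => ?_
  simp [Matrix.conjTranspose_smul, Matrix.conjTranspose_vecMulVec]

/-- Von Neumann entropy `-tr (ρ log ρ)` (natural logarithm): the sum of `-λ log λ` over the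
eigenvalues `λ` of `ρ`, with multiplicity. -/
noncomputable def vonNeumannEntropy {d : ℕ} (ρ : Matrix (Fin d) (Fin d) ℂ) (h : ρ.IsHermitian) :
    ℝ :=
  ∑ i, Real.negMulLog (h.eigenvalues i)

/-- The quantum complexity of a quantum model whose causal states occur with probabilities `π`. -/
noncomputable def QuantumModel.complexity {T : X → Y → Matrix S S ℝ} (q : QuantumModel T)
    (π : S → ℝ) : ℝ :=
  vonNeumannEntropy (q.averageState π) (q.averageState_isHermitian π)

end Quantum

/-! ### Classical and quantum complexity of an input-output process -/

namespace InputOutputProcess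

variable {X Y : Type} [Fintype X] [Fintype Y]

/-- `C` is the statistical complexity of `A` driven by the IID input `I`: the Shannon entropy of
the stationary distribution over the causal states of `A`. -/
def IsStatisticalComplexity (A : InputOutputProcess X Y) (I : X → ℝ) (C : ℝ) : Prop :=
  ∃ (n : ℕ) (ε : JointPast X Y → Fin n) (T : X → Y → Matrix (Fin n) (Fin n) ℝ) (π : Fin n → ℝ),
    A.IsEpsilonTransducer ε T ∧ IsTheStationaryDistribution T I π ∧ C = shannonEntropy π

/-- `Q` is the optimal quantum complexity of `A` driven by the IID input `I`: the minimum of the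
quantum complexity over all quantum models of `A`. -/
def IsOptimalQuantumComplexity [DecidableEq X] [DecidableEq Y] (A : InputOutputProcess X Y)
    (I : X → ℝ) (Q : ℝ) : Prop :=
  ∃ (n : ℕ) (ε : JointPast X Y → Fin n) (T : X → Y → Matrix (Fin n) (Fin n) ℝ) (π : Fin n → ℝ),
    A.IsEpsilonTransducer ε T ∧ IsTheStationaryDistribution T I π ∧
      IsLeast (Set.range fun q : QuantumModel T => q.complexity π) Q

/-- Driven by `I₁` instead of `I₂`, the process `A` is classically more complex,
but quantum mechanically less complex. -/
def AmbiguousOrdering [DecidableEq X] [DecidableEq Y] (A : InputOutputProcess X Y)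
    (I₁ I₂ : X → ℝ) : Prop :=
  ∃ C₁ C₂ Q₁ Q₂ : ℝ,
    A.IsStatisticalComplexity I₁ C₁ ∧ A.IsStatisticalComplexity I₂ C₂ ∧
    A.IsOptimalQuantumComplexity I₁ Q₁ ∧ A.IsOptimalQuantumComplexity I₂ Q₂ ∧
    C₂ < C₁ ∧ Q₁ < Q₂

end InputOutputProcess

/-! ### The three-state family -/

/-- The transition probabilities of the 6-parameter family, as matrices `T x y` for input `x` and
output `y`. The states are `0 = f`, `1 = e`, `2 = u`. -/
def investorTransitions (p₁ p₂ p₃ q₁ q₂ q₃ : ℝ) : Fin 3 → Fin 3 → Matrix (Fin 3) (Fin 3) ℝ :=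
  ![![!![0, 0, p₁; p₃, 0, 0; 0, 0, 1 - p₂], !![0, 1 - p₁, 0; 0, 1 - p₃, 0; 0, p₂, 0], 0],
    ![!![0, 0, q₁; q₃, 0, 0; 0, 0, 1 - q₂], !![0, 1 - q₁, 0; 0, 1 - q₃, 0; 0, q₂, 0], 0],
    ![0, 0, !![0, 1, 0; 0, 1, 0; 0, 1, 0]]]

/-! The choice p₁ = p₂ = 0 makes u perfectly distinguishable from f and e, while f and e can share
part of their memory. A unitary preserves inner products, so the overlaps of the memory states
satisfy a linear consistency equation for each input (`QuantumModel.overlap_eq`). Input 0 alone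
forces ⟨f|u⟩ = ⟨e|u⟩ = 0 and |⟨f|e⟩|² ≤ 3/7. Orthogonal junk for u and suitable junk overlaps for f
and e attain 3/7. Entropy decreases in this overlap, so a single model is optimal for every input
distribution (`isLeast_complexity`).

Under IID driving the ratio r of f to e does not involve q₁, and the odds of u against the rest are
proportional to q₁. Grouping the outcomes expresses both complexities as `mixEntropy (w * q₁) H`,
where H is the binary entropy of r/(1+r) classically and of the smaller eigenvalue of the f-e block
quantum mechanically. The input I₁ has the larger H and I₂ the larger w. Quantum compression narrows
the gap in H and leaves the contribution of u untouched, so the order can flip.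

To cover a whole interval of q₁, `mixEntropy_sub_monotoneOn` shows that the entropy for I₂ minus
that for I₁ increases with q₁, classically and quantum mechanically. Hence the classical inequality
is needed only at the right end and the quantum one only at the left end. Both follow from rational
enclosures of logarithms. -/

/-! ### The transducer and its causal states -/

/-- The causal state reached from `i` when the output is `y`. -/
def nextState (i y : Fin 3) : Fin 3 := if y = 0 then (if i = 1 then 0 else 2) else 1

/-- The probability of the output `y` on input `x` in state `i`. -/
def outputProb (p₁ p₂ p₃ q₁ q₂ q₃ : ℝ) : Fin 3 → Fin 3 → Fin 3 → ℝ :=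
  ![![![p₁, 1 - p₁, 0], ![p₃, 1 - p₃, 0], ![1 - p₂, p₂, 0]],
    ![![q₁, 1 - q₁, 0], ![q₃, 1 - q₃, 0], ![1 - q₂, q₂, 0]],
    ![![0, 0, 1], ![0, 0, 1], ![0, 0, 1]]]

theorem investorTransitions_apply (p₁ p₂ p₃ q₁ q₂ q₃ : ℝ) (x y i j : Fin 3) :
    investorTransitions p₁ p₂ p₃ q₁ q₂ q₃ x y i j =
      if j = nextState i y then outputProb p₁ p₂ p₃ q₁ q₂ q₃ x i y else 0 := by
  fin_cases x <;> fin_cases y <;> fin_cases i <;> fin_cases j <;> rfl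

theorem outputProb_nonneg {q : ℝ} (hq₀ : 0 ≤ q) (hq₁ : q ≤ 1) (x i y : Fin 3) :
    0 ≤ outputProb 0 0 (4 / 7) q (3 / 5) (1 / 100) x i y := by
  fin_cases x <;> fin_cases i <;> fin_cases y <;> norm_num [outputProb, hq₀, hq₁]

theorem outputProb_sum (p₁ p₂ p₃ q₁ q₂ q₃ : ℝ) (x i : Fin 3) :
    ∑ y, outputProb p₁ p₂ p₃ q₁ q₂ q₃ x i y = 1 := by
  fin_cases x <;> fin_cases i <;> simp [outputProb, Fin.sum_univ_three]

/-- The causal state reached after a joint past: it is determined by the number of zeros at the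
end of the output sequence. -/
def causalState (z : JointPast (Fin 3) (Fin 3)) : Fin 3 :=
  if (z 0).2 = 0 then (if (z 1).2 = 0 then 2 else 0) else 1

theorem causalState_extend (z : JointPast (Fin 3) (Fin 3)) (x y : Fin 3) :
    causalState (z.extend x y) = nextState (causalState z) y := by
  unfold causalState nextState
  simp only [JointPast.extend]
  by_cases h : (z 0).2 = 0 <;> by_cases h' : (z 1).2 = 0 <;> simp [h, h']

/-- The input-output process `A_{q₁}`. -/
noncomputable def aqProcess (q : ℝ) (hq₀ : 0 ≤ q) (hq₁ : q ≤ 1) :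
    InputOutputProcess (Fin 3) (Fin 3) where
  prob z x y := outputProb 0 0 (4 / 7) q (3 / 5) (1 / 100) x (causalState z) y
  prob_nonneg _ x y := outputProb_nonneg hq₀ hq₁ x _ y
  prob_sum _ x := outputProb_sum _ _ _ _ _ _ x _

theorem aqProcess_futureProb_congr {q : ℝ} (hq₀ : 0 ≤ q) (hq₁ : q ≤ 1)
    (w : List (Fin 3 × Fin 3)) : ∀ z z', causalState z = causalState z' →
      (aqProcess q hq₀ hq₁).futureProb z w = (aqProcess q hq₀ hq₁).futureProb z' w := by
  induction w with
  | nil => intro z z' _; rfl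
  | cons p w ih =>
    obtain ⟨x, y⟩ := p
    intro z z' h
    simp only [InputOutputProcess.futureProb]
    rw [ih (z.extend x y) (z'.extend x y) (by rw [causalState_extend, causalState_extend, h])]
    simp only [aqProcess, h]

theorem InputOutputProcess.Admissible.extend {X Y : Type} [Fintype Y]
    {A : InputOutputProcess X Y} {z : JointPast X Y} (hz : A.Admissible z) {x : X} {y : Y}
    (h : 0 < A.prob z x y) : A.Admissible (z.extend x y)
  | 0 => h
  | k + 1 => hz k

theorem aqProcess_isEpsilonTransducer {q : ℝ} (hq₀ : 0 ≤ q) (hq₁ : q ≤ 1) :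
    (aqProcess q hq₀ hq₁).IsEpsilonTransducer causalState
      (investorTransitions 0 0 (4 / 7) q (3 / 5) (1 / 100)) where
  surjective s := by
    have he : (aqProcess q hq₀ hq₁).Admissible fun _ => (2, 2) := fun _ => by
      simp [aqProcess, causalState, outputProb, JointPast.drop]
    fin_cases s
    · refine ⟨_, he.extend (x := 0) (y := 0) ?_, ?_⟩
      · simp [aqProcess, causalState, outputProb]
      · simp [causalState, JointPast.extend]
    · exact ⟨_, he, by simp [causalState]⟩
    · exact ⟨fun _ => (0, 0), fun _ => by
        simp [aqProcess, causalState, outputProb, JointPast.drop], by simp [causalState]⟩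
  eq_iff z z' _ _ := by
    refine ⟨fun h w => aqProcess_futureProb_congr hq₀ hq₁ w z z' h, fun h => ?_⟩
    -- One letter suffices: on input 0 the output 0 has probability 0, 4/7 and 1 in f, e and u.
    have h0 := h [(0, 0)]
    simp only [InputOutputProcess.futureProb, aqProcess, mul_one] at h0
    clear h
    generalize causalState z = s at *
    generalize causalState z' = s' at *
    fin_cases s <;> fin_cases s' <;> first | rfl | (exfalso; norm_num [outputProb] at h0)
  transition z _ x y j := by
    rw [causalState_extend, investorTransitions_apply]
    simp only [aqProcess, eq_comm]

/-! ### The stationary distribution -/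

/-- The distribution over the states `f, e, u` in which `f : e = r : 1` and
`u : (f or e) = w : 1`. -/
noncomputable def ratioDist (r w : ℝ) : Fin 3 → ℝ :=
  ![r / ((1 + r) * (1 + w)), 1 / ((1 + r) * (1 + w)), w / (1 + w)]

/-- Balance at f fixes the ratio of f to e, balance at u fixes the odds of u, and normalisation
fixes the scale. Balance at e is then automatic, since probability is conserved. -/
theorem isTheStationaryDistribution_ratioDist {q r w a b c : ℝ} (hr : 0 < r) (hw : 0 < w)
    (habc : a + b + c = 1) (hab : a + 2 / 5 * b < 1) (hr' : r = 4 / 7 * a + 1 / 100 * b)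
    (hw' : (1 - a - 2 / 5 * b) * (w * (1 + r)) = r * b * q) :
    IsTheStationaryDistribution (investorTransitions 0 0 (4 / 7) q (3 / 5) (1 / 100)) ![a, b, c]
      (ratioDist r w) := by
  intro p
  have h1 : (1 + r) ≠ 0 := by positivity
  have h2 : (1 + w) ≠ 0 := by positivity
  have hc : c = 1 - a - b := by linarith
  have hsys : IsStationaryDistribution
      (investorTransitions 0 0 (4 / 7) q (3 / 5) (1 / 100)) ![a, b, c] p ↔
      ((0 ≤ p 0 ∧ 0 ≤ p 1 ∧ 0 ≤ p 2) ∧ p 0 + p 1 + p 2 = 1) ∧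
      p 1 * (4 / 7 * a + 1 / 100 * b) = p 0 ∧
      p 0 * (a + (1 - q) * b + c) + p 1 * ((1 - 4 / 7) * a + (1 - 1 / 100) * b + c)
        + p 2 * (3 / 5 * b + c) = p 1 ∧ p 0 * (b * q) + p 2 * (a + 2 / 5 * b) = p 2 := by
    unfold IsStationaryDistribution
    simp only [stdSimplex, Set.mem_ofPred_eq, Fin.forall_fin_succ, Fin.sum_univ_three,
      investorTransitions_apply]
    simp [nextState, outputProb]
    intro _ _ _ _
    constructor <;> rintro ⟨h0, h1, h2⟩ <;>
      exact ⟨by linear_combination h0, by linear_combination h1, by linear_combination h2⟩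
  rw [hsys]
  constructor
  · rintro ⟨⟨_, hs⟩, h0, h1', h2'⟩
    have e0 : p 0 = r * p 1 := by rw [← h0, hr']; ring
    have e2 : p 2 = w * ((1 + r) * p 1) := by
      -- This is the probability of leaving u; it must be positive for the balance at u to determine
      -- `p 2`.
      have hk : 1 - a - 2 / 5 * b ≠ 0 := by linarith
      apply mul_left_cancel₀ hk
      rw [e0] at h2'
      linear_combination -h2' - p 1 * hw'
    have e1 : p 1 = 1 / ((1 + r) * (1 + w)) := by
      rw [e0, e2] at hs
      field_simp
      linear_combination hs
    funext i
    fin_cases i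
    · simp [ratioDist, e0, e1]; field_simp
    · simp [ratioDist, e1]
    · simp [ratioDist, e2, e1]; field_simp
  · rintro rfl
    have e0 : ratioDist r w 1 * (4 / 7 * a + 1 / 100 * b) = ratioDist r w 0 := by
      rw [← hr']
      simp only [ratioDist, Matrix.cons_val]
      ring
    have e2 : ratioDist r w 0 * (b * q) + ratioDist r w 2 * (a + 2 / 5 * b) = ratioDist r w 2 := by
      simp only [ratioDist, Matrix.cons_val]
      field_simp
      linear_combination -5 * hw'
    refine ⟨⟨?_, ?_⟩, e0, ?_, e2⟩
    · simp only [ratioDist, Matrix.cons_val]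
      exact ⟨by positivity, by positivity, by positivity⟩
    · simp only [ratioDist, Matrix.cons_val]
      field_simp
      ring
    · rw [hc]
      linear_combination -e0 - e2

/-! ### Unitaries, Gram matrices and overlaps of memory states -/

/-- Two families of vectors with the same Gram matrix are related by a unitary matrix. -/
theorem exists_unitary_of_gram_eq {n κ : Type} [Fintype n] [DecidableEq n] [Fintype κ]
    (v w : κ → n → ℂ) (h : ∀ k l, star (v k) ⬝ᵥ v l = star (w k) ⬝ᵥ w l) :
    ∃ U ∈ Matrix.unitaryGroup n ℂ, ∀ k, U *ᵥ v k = w k := by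
  classical
  let A : (κ → ℂ) →ₗ[ℂ] EuclideanSpace ℂ n := Fintype.linearCombination ℂ fun k => WithLp.toLp 2 (v k)
  let B : (κ → ℂ) →ₗ[ℂ] EuclideanSpace ℂ n := Fintype.linearCombination ℂ fun k => WithLp.toLp 2 (w k)
  have hin : ∀ c, inner ℂ (A c) (A c) = inner ℂ (B c) (B c) := by
    intro c
    simp only [A, B, Fintype.linearCombination_apply, sum_inner, inner_sum, inner_smul_left,
      inner_smul_right, EuclideanSpace.inner_eq_star_dotProduct]
    refine Finset.sum_congr rfl fun k _ => congrArg _ (Finset.sum_congr rfl fun l _ => ?_)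
    rw [dotProduct_comm, h, dotProduct_comm]
  have hnorm : ∀ c, ‖A c‖ = ‖B c‖ := by
    intro c
    rw [@norm_eq_sqrt_re_inner ℂ, @norm_eq_sqrt_re_inner ℂ, hin]
  obtain ⟨g, hg⟩ := A.rangeRestrict.exists_rightInverse_of_surjective
    (LinearMap.range_rangeRestrict A)
  have hg' : ∀ x, A (g x) = x := fun x => by
    have := congrArg Subtype.val (LinearMap.congr_fun hg x)
    simpa using this
  let L₀ : LinearMap.range A →ₗᵢ[ℂ] EuclideanSpace ℂ n :=
    { toLinearMap := B ∘ₗ g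
      norm_map' := fun x => by
        change ‖B (g x)‖ = ‖(x : EuclideanSpace ℂ n)‖
        rw [← hnorm, hg'] }
  -- The choice of preimage `g` is immaterial: equal norms give `A` and `B` the same kernel.
  have hL₀ : ∀ c, L₀ ⟨A c, c, rfl⟩ = B c := by
    intro c
    change B (g _) = B c
    rw [← sub_eq_zero, ← map_sub, ← norm_eq_zero, ← hnorm, map_sub, hg']
    simp
  -- In finite dimension an isometry of a subspace into the space extends to the whole space.
  let L := L₀.extend
  have hL : ∀ k, L (WithLp.toLp 2 (v k)) = WithLp.toLp 2 (w k) := by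
    intro k
    have hA : A (Pi.single k 1) = WithLp.toLp 2 (v k) := by
      simp [A]
    have hB : B (Pi.single k 1) = WithLp.toLp 2 (w k) := by
      simp [B]
    rw [← hA, ← hB, ← hL₀]
    exact LinearIsometry.extend_apply L₀ ⟨A (Pi.single k 1), _, rfl⟩
  let f : (n → ℂ) →ₗ[ℂ] (n → ℂ) :=
    (WithLp.linearEquiv 2 ℂ (n → ℂ)).toLinearMap ∘ₗ L.toLinearMap ∘ₗ
      (WithLp.linearEquiv 2 ℂ (n → ℂ)).symm.toLinearMap
  have hf : ∀ x, LinearMap.toMatrix' f *ᵥ x = (L (WithLp.toLp 2 x)).ofLp := by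
    intro x
    rw [LinearMap.toMatrix'_mulVec]
    rfl
  refine ⟨LinearMap.toMatrix' f, ?_, fun k => by rw [hf, hL]⟩
  rw [Matrix.mem_unitaryGroup_iff', Matrix.star_eq_conjTranspose]
  ext i j
  have h1 : ((LinearMap.toMatrix' f)ᴴ * LinearMap.toMatrix' f) i j =
      star (LinearMap.toMatrix' f *ᵥ Pi.single i 1) ⬝ᵥ
        (LinearMap.toMatrix' f *ᵥ Pi.single j 1) := by
    simp [Matrix.mul_apply, dotProduct]
  rw [h1, hf, hf, dotProduct_comm, ← EuclideanSpace.inner_eq_star_dotProduct, L.inner_map_map,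
    EuclideanSpace.inner_eq_star_dotProduct]
  simp [Matrix.one_apply, Pi.single_apply]

theorem norm_star_dotProduct_le_one {n : Type} [Fintype n] {v w : n → ℂ}
    (hv : star v ⬝ᵥ v = 1) (hw : star w ⬝ᵥ w = 1) : ‖star v ⬝ᵥ w‖ ≤ 1 := by
  have key : ∀ u : n → ℂ, star u ⬝ᵥ u = 1 → ‖WithLp.toLp 2 u‖ = 1 := by
    intro u hu
    rw [@norm_eq_sqrt_re_inner ℂ, EuclideanSpace.inner_eq_star_dotProduct, dotProduct_comm]
    simp [hu]
  have := norm_inner_le_norm (𝕜 := ℂ) (WithLp.toLp 2 v) (WithLp.toLp 2 w)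
  rwa [key v hv, key w hw, EuclideanSpace.inner_eq_star_dotProduct, dotProduct_comm,
    one_mul] at this

theorem star_registerState_dotProduct {X Y : Type} [Fintype X] [Fintype Y] [DecidableEq X]
    [DecidableEq Y] {d m : ℕ} (v v' : Fin d → ℂ) (x x' : X) (y y' : Y) (a a' : Fin m → ℂ) :
    star (registerState v x y a) ⬝ᵥ registerState v' x' y' a' =
      if x = x' ∧ y = y' then (star v ⬝ᵥ v') * (star a ⬝ᵥ a') else 0 := by
  have : star (registerState v x y a) ⬝ᵥ registerState v' x' y' a' =
      (∑ k, star (v k) * v' k) * ((∑ k, star ((Pi.single x (1 : ℂ) : X → ℂ) k) *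
        (Pi.single x' (1 : ℂ) : X → ℂ) k) * ((∑ k, star ((Pi.single y (1 : ℂ) : Y → ℂ) k) *
        (Pi.single y' (1 : ℂ) : Y → ℂ) k) * ∑ k, star (a k) * a' k)) := by
    simp only [dotProduct, Fintype.sum_prod_type, Finset.sum_mul, registerState, Pi.star_apply]
    simp only [Finset.mul_sum]
    refine Finset.sum_congr rfl fun _ _ => Finset.sum_congr rfl fun _ _ =>
      Finset.sum_congr rfl fun _ _ => Finset.sum_congr rfl fun _ _ => ?_
    simp only [star_mul']
    ring
  rw [this]
  have hs : ∀ {Z : Type} [Fintype Z] [DecidableEq Z] (z z' : Z),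
      ∑ k, star ((Pi.single z (1 : ℂ) : Z → ℂ) k) * (Pi.single z' (1 : ℂ) : Z → ℂ) k =
        if z = z' then 1 else 0 := by
    intro Z _ _ z z'
    by_cases h : z = z'
    · simp [Pi.single_apply, h]
    · simp [Pi.single_apply, h, Ne.symm h]
  rw [hs, hs]
  by_cases hx : x = x' <;> by_cases hy : y = y' <;> simp [hx, hy, dotProduct]

/-- State and output determine the next state, so each sum over `j` has one term; orthogonality of
the tape registers then leaves only equal inputs and equal outputs. -/
theorem star_evolution_dotProduct {X Y S : Type} [Fintype X] [Fintype Y] [Fintype S]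
    [DecidableEq X] [DecidableEq Y] [DecidableEq S] {d m : ℕ} {T : X → Y → Matrix S S ℝ}
    {p : X → S → Y → ℝ} {nxt : S → Y → S} (hT : ∀ x y i j, T x y i j =
      if j = nxt i y then p x i y else 0) (s : S → Fin d → ℂ) (junk : S → X → Y → Fin m → ℂ)
    (i i' : S) (x x' : X) :
    star (∑ y, ∑ j, ((Real.sqrt (T x y i j) : ℝ) : ℂ) • registerState (s j) x y (junk i x y)) ⬝ᵥ
      (∑ y, ∑ j, ((Real.sqrt (T x' y i' j) : ℝ) : ℂ) •
        registerState (s j) x' y (junk i' x' y)) =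
    if x = x' then ∑ y, (Real.sqrt (p x i y) * Real.sqrt (p x i' y) : ℝ) *
      ((star (s (nxt i y)) ⬝ᵥ s (nxt i' y)) * (star (junk i x y) ⬝ᵥ junk i' x y)) else 0 := by
  have hred : ∀ i x, ∑ y, ∑ j, ((Real.sqrt (T x y i j) : ℝ) : ℂ) •
      registerState (s j) x y (junk i x y) = ∑ y, ((Real.sqrt (p x i y) : ℝ) : ℂ) •
      registerState (s (nxt i y)) x y (junk i x y) := by
    intro i x
    refine Finset.sum_congr rfl fun y _ => ?_
    rw [Finset.sum_eq_single (nxt i y)]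
    · simp [hT]
    · intro j _ hj
      simp [hT, hj]
    · simp
  rw [hred, hred, star_sum, sum_dotProduct]
  simp only [dotProduct_sum, star_smul, smul_dotProduct, dotProduct_smul,
    star_registerState_dotProduct]
  by_cases hx : x = x'
  · subst hx
    simp [mul_assoc, mul_left_comm]
  · simp [hx]

theorem star_mulVec_dotProduct_of_mem_unitaryGroup {n : Type} [Fintype n] [DecidableEq n]
    {U : Matrix n n ℂ} (hU : U ∈ Matrix.unitaryGroup n ℂ) (v w : n → ℂ) :
    star (U *ᵥ v) ⬝ᵥ (U *ᵥ w) = star v ⬝ᵥ w := by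
  rw [Matrix.star_mulVec, Matrix.dotProduct_mulVec, Matrix.vecMul_vecMul,
    ← Matrix.star_eq_conjTranspose, (Matrix.mem_unitaryGroup_iff').1 hU, Matrix.vecMul_one]

/-- The overlaps of the memory states of a quantum model satisfy a consistency equation. -/
theorem QuantumModel.overlap_eq {X Y S : Type} [Fintype X] [Fintype Y] [Fintype S]
    [DecidableEq X] [DecidableEq Y] [DecidableEq S] {T : X → Y → Matrix S S ℝ}
    {p : X → S → Y → ℝ} {nxt : S → Y → S} (hT : ∀ x y i j, T x y i j =
      if j = nxt i y then p x i y else 0) (q : QuantumModel T) (i i' : S) (x : X) :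
    star (q.state i) ⬝ᵥ q.state i' = ∑ y, (Real.sqrt (p x i y) * Real.sqrt (p x i' y) : ℝ) *
      ((star (q.state (nxt i y)) ⬝ᵥ q.state (nxt i' y)) *
        (star (q.junk i x y) ⬝ᵥ q.junk i' x y)) := by
  have h := star_mulVec_dotProduct_of_mem_unitaryGroup q.U_unitary
    (registerState (q.state i) x q.y₀ (Pi.single q.a₀ 1))
    (registerState (q.state i') x q.y₀ (Pi.single q.a₀ 1))
  rw [q.evolution, q.evolution, star_evolution_dotProduct hT, star_registerState_dotProduct] at h
  simpa using h.symm

/-! ### Von Neumann entropy as a function of the overlap -/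

/-- Concavity: the closer pair consists of convex combinations of the wider pair with weights (1 ±
D/D')/2, and the two inequalities add up. -/
theorem negMulLog_add_antitone {s D D' : ℝ} (hD : 0 ≤ D) (hDD : D ≤ D') (hs : D' ≤ s) :
    Real.negMulLog ((s + D') / 2) + Real.negMulLog ((s - D') / 2) ≤
      Real.negMulLog ((s + D) / 2) + Real.negMulLog ((s - D) / 2) := by
  have m₁ : (s + D') / 2 ∈ Set.Ici (0 : ℝ) := by simp; linarith
  have m₂ : (s - D') / 2 ∈ Set.Ici (0 : ℝ) := by simp; linarith
  obtain ⟨-, hc⟩ := Real.concaveOn_negMulLog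
  rcases hD.eq_or_lt' with rfl | hpos
  · rcases hDD.eq_or_lt' with rfl | hpos'
    · exact le_rfl
    have h := hc m₁ m₂ (show (0 : ℝ) ≤ 1 / 2 by norm_num) (show (0 : ℝ) ≤ 1 / 2 by norm_num)
      (by norm_num)
    have e : (1 / 2 : ℝ) • ((s + D') / 2) + (1 / 2 : ℝ) • ((s - D') / 2) = s / 2 := by
      simp only [smul_eq_mul]; ring
    rw [e] at h
    simp only [smul_eq_mul] at h
    simp only [add_zero, sub_zero]
    linarith
  have hD' : 0 < D' := hpos.trans_le hDD
  have ha : 0 ≤ (1 + D / D') / 2 := by positivity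
  have hb : 0 ≤ (1 - D / D') / 2 := by
    have : D / D' ≤ 1 := (div_le_one hD').2 hDD
    linarith
  have h₁ := hc m₁ m₂ ha hb (by ring)
  have h₂ := hc m₁ m₂ hb ha (by ring)
  have e₁ : ((1 + D / D') / 2) • ((s + D') / 2) + ((1 - D / D') / 2) • ((s - D') / 2)
      = (s + D) / 2 := by
    simp only [smul_eq_mul]; field_simp; ring
  have e₂ : ((1 - D / D') / 2) • ((s + D') / 2) + ((1 + D / D') / 2) • ((s - D') / 2)
      = (s - D) / 2 := by
    simp only [smul_eq_mul]; field_simp; ring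
  rw [e₁] at h₁
  rw [e₂] at h₂
  simp only [smul_eq_mul] at h₁ h₂
  linarith

/-- The von Neumann entropy of `V Vᴴ` is determined by the roots of the characteristic polynomial
of `Vᴴ V`. -/
theorem vonNeumannEntropy_mul_conjTranspose {d : ℕ} {n : Type} [Fintype n] [DecidableEq n]
    (ρ : Matrix (Fin d) (Fin d) ℂ) (hρ : ρ.IsHermitian) (V : Matrix (Fin d) n ℂ)
    (hV : ρ = V * Vᴴ) :
    vonNeumannEntropy ρ hρ =
      ((Vᴴ * V).charpoly.roots.map fun z => Real.negMulLog z.re).sum := by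
  have h1 : vonNeumannEntropy ρ hρ = (ρ.charpoly.roots.map fun z => Real.negMulLog z.re).sum := by
    rw [hρ.roots_charpoly_eq_eigenvalues, Multiset.map_map]
    rfl
  -- The two characteristic polynomials agree up to powers of `X`, and the extra roots 0 contribute
  -- nothing because `negMulLog 0 = 0`.
  have h2 := congrArg (fun P => (P.roots.map fun z : ℂ => Real.negMulLog z.re).sum)
    (Matrix.charpoly_mul_comm' V Vᴴ)
  have hne : ∀ (k : ℕ) {m : Type} [Fintype m] [DecidableEq m] (M : Matrix m m ℂ),
      (Polynomial.X ^ k : Polynomial ℂ) * M.charpoly ≠ 0 := fun k _ _ _ M =>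
    mul_ne_zero (pow_ne_zero _ Polynomial.X_ne_zero) M.charpoly_monic.ne_zero
  simp only [Polynomial.roots_mul (hne _ _), Polynomial.roots_pow, Polynomial.roots_X,
    Multiset.map_add, Multiset.sum_add, Multiset.map_nsmul, Multiset.map_singleton,
    Multiset.sum_nsmul, Multiset.sum_singleton, Complex.zero_re, Real.negMulLog_zero,
    smul_zero, zero_add] at h2
  rw [h1, hV, h2]

/-- The entropy of `ρ` when the memory state of `u` is orthogonal to those of `f` and `e`, whose
squared overlap is `t`. -/
noncomputable def overlapEntropy (π : Fin 3 → ℝ) (t : ℝ) : ℝ :=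
  Real.negMulLog (π 2) +
    (Real.negMulLog ((π 0 + π 1 + √((π 0 + π 1) ^ 2 - 4 * (π 0 * π 1 * (1 - t)))) / 2) +
    Real.negMulLog ((π 0 + π 1 - √((π 0 + π 1) ^ 2 - 4 * (π 0 * π 1 * (1 - t)))) / 2))

theorem overlapEntropy_antitoneOn {π : Fin 3 → ℝ} (h0 : 0 ≤ π 0) (h1 : 0 ≤ π 1) {t t' : ℝ}
    (htt : t ≤ t') (ht' : t' ≤ 1) : overlapEntropy π t' ≤ overlapEntropy π t := by
  unfold overlapEntropy
  have hp : 0 ≤ π 0 * π 1 := mul_nonneg h0 h1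
  refine add_le_add le_rfl ?_
  apply negMulLog_add_antitone (Real.sqrt_nonneg _)
  · apply Real.sqrt_le_sqrt
    nlinarith
  · apply Real.sqrt_le_iff.2 ⟨by linarith, by nlinarith⟩

/-- The nonzero spectrum of ρ is that of the weighted Gram matrix, which splits into the entry `π 2`
and a 2 × 2 block with trace `π 0 + π 1` and determinant `π 0 * π 1 * (1 - t)`. -/
theorem QuantumModel.complexity_eq_overlapEntropy {X Y : Type} [Fintype X] [Fintype Y]
    [DecidableEq X] [DecidableEq Y] {T : X → Y → Matrix (Fin 3) (Fin 3) ℝ} (q : QuantumModel T)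
    {π : Fin 3 → ℝ} (hπ : ∀ i, 0 ≤ π i) (h02 : star (q.state 0) ⬝ᵥ q.state 2 = 0)
    (h12 : star (q.state 1) ⬝ᵥ q.state 2 = 0) {t : ℝ}
    (ht : t = ‖star (q.state 0) ⬝ᵥ q.state 1‖ ^ 2) (ht1 : t ≤ 1) :
    q.complexity π = overlapEntropy π t := by
  let V : Matrix (Fin q.d) (Fin 3) ℂ := Matrix.of fun k i => (√(π i) : ℂ) * q.state i k
  have hV : q.averageState π = V * Vᴴ := by
    ext k l
    simp only [QuantumModel.averageState, Matrix.sum_apply, Matrix.smul_apply, Matrix.vecMulVec,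
      Matrix.mul_apply, Matrix.conjTranspose_apply, V, Matrix.of_apply, smul_eq_mul, Pi.star_apply]
    refine Finset.sum_congr rfl fun i _ => ?_
    have : ((π i : ℝ) : ℂ) = (√(π i) : ℂ) * (√(π i) : ℂ) := by
      rw [← Complex.ofReal_mul, Real.mul_self_sqrt (hπ i)]
    rw [this, star_mul']
    simp only [Complex.star_def, Complex.conj_ofReal]
    ring
  have hM : ∀ i j, (Vᴴ * V) i j = (√(π i) : ℂ) * √(π j) * (star (q.state i) ⬝ᵥ q.state j) := by
    intro i j
    simp only [Matrix.mul_apply, Matrix.conjTranspose_apply, V, Matrix.of_apply, dotProduct,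
      Finset.mul_sum, star_mul', Pi.star_apply, Complex.star_def, Complex.conj_ofReal]
    exact Finset.sum_congr rfl fun _ _ => by ring
  have hswap : ∀ i j, star (q.state j) ⬝ᵥ q.state i = star (star (q.state i) ⬝ᵥ q.state j) := by
    intro i j
    rw [Matrix.star_dotProduct]
  have h20 : star (q.state 2) ⬝ᵥ q.state 0 = 0 := by rw [hswap, h02, star_zero]
  have h21 : star (q.state 2) ⬝ᵥ q.state 1 = 0 := by rw [hswap, h12, star_zero]
  set c := star (q.state 0) ⬝ᵥ q.state 1 with hc
  have hcc : c * star c = (t : ℂ) := by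
    rw [ht, Complex.star_def, Complex.mul_conj, Complex.normSq_eq_norm_sq]
  have h10 : star (q.state 1) ⬝ᵥ q.state 0 = star c := hswap 0 1
  have hsq : ∀ i, (√(π i) : ℂ) * √(π i) = (π i : ℂ) := fun i => by
    rw [← Complex.ofReal_mul, Real.mul_self_sqrt (hπ i)]
  set R := √((π 0 + π 1) ^ 2 - 4 * (π 0 * π 1 * (1 - t))) with hR
  have hp : 0 ≤ π 0 * π 1 := mul_nonneg (hπ 0) (hπ 1)
  have ht0 : 0 ≤ t := by rw [ht]; positivity
  have hRR : (R : ℂ) * R = ((π 0 : ℂ) + π 1) ^ 2 - 4 * (π 0 * π 1 * (1 - t)) := by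
    -- The discriminant equals (π₀ − π₁)² + 4π₀π₁t, hence is nonnegative.
    rw [← Complex.ofReal_mul, hR, Real.mul_self_sqrt (by nlinarith [sq_nonneg (π 0 - π 1)])]
    push_cast
    ring
  have hchar : (Vᴴ * V).charpoly =
      (({((π 2 : ℝ) : ℂ), (((π 0 + π 1 + R) / 2 : ℝ) : ℂ), (((π 0 + π 1 - R) / 2 : ℝ) : ℂ)} :
        Multiset ℂ).map fun a => Polynomial.X - Polynomial.C a).prod := by
    apply Polynomial.funext
    intro z
    rw [Matrix.eval_charpoly, Matrix.det_fin_three]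
    simp only [Matrix.sub_apply, Matrix.scalar_apply, Matrix.diagonal_apply, hM, h02, h12, h20,
      h21, h10, q.state_norm, ← hc, Multiset.insert_eq_cons, Multiset.map_cons, Multiset.prod_cons,
      Multiset.map_singleton, Multiset.prod_singleton, Polynomial.eval_mul, Polynomial.eval_sub,
      Polynomial.eval_X, Polynomial.eval_C, mul_one, hsq]
    simp
    rw [Complex.star_def] at hcc
    linear_combination (z - π 2) * (hRR / 4 - (hsq 0 * (√(π 1) * √(π 1)) * (c * starRingEnd ℂ c) +
      π 0 * hsq 1 * (c * starRingEnd ℂ c) + π 0 * π 1 * hcc))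
  unfold QuantumModel.complexity
  rw [vonNeumannEntropy_mul_conjTranspose _ _ V hV, hchar, Polynomial.roots_multiset_prod_X_sub_C]
  simp only [Multiset.insert_eq_cons, Multiset.map_cons, Multiset.sum_cons, Multiset.map_singleton,
    Multiset.sum_singleton, Complex.ofReal_re]
  rfl

/-! ### The optimal quantum model -/

/-- Three unit vectors, of which the last is orthogonal to the other two and these have
overlap `γ`. -/
noncomputable def overlapTriple (γ : ℝ) : Fin 3 → Fin 3 → ℂ :=
  ![![1, 0, 0], ![(γ : ℂ), (√(1 - γ ^ 2) : ℂ), 0], ![0, 0, 1]]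

theorem star_overlapTriple_dotProduct {γ : ℝ} (hγ : γ ^ 2 ≤ 1) (i j : Fin 3) :
    star (overlapTriple γ i) ⬝ᵥ overlapTriple γ j =
      (!![1, γ, 0; γ, 1, 0; 0, 0, 1] : Matrix (Fin 3) (Fin 3) ℝ) i j := by
  have h : (√(1 - γ ^ 2) : ℂ) * (√(1 - γ ^ 2) : ℂ) = 1 - (γ : ℂ) ^ 2 := by
    rw [← Complex.ofReal_mul, Real.mul_self_sqrt (by linarith)]
    push_cast
    rfl
  fin_cases i <;> fin_cases j <;>
    (simp [overlapTriple, dotProduct, Fin.sum_univ_three, h]; try ring)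

/-- This is the Gram condition for the optimal model. The f-e junk overlap for each input is solved
from ⟨f|e⟩ = √(3/7); the junk of u is orthogonal to the rest, which removes the terms where u and
another state reach the same successor. -/
theorem overlap_optimal_consistent {q : ℝ} (hq₀ : 0 ≤ q) (hq₁ : q ≤ 54 / 100) (i i' x : Fin 3) :
    (!![1, √(3 / 7), 0; √(3 / 7), 1, 0; 0, 0, 1] : Matrix (Fin 3) (Fin 3) ℝ) i i' =
    ∑ y, (√(outputProb 0 0 (4 / 7) q (3 / 5) (1 / 100) x i y) *
      √(outputProb 0 0 (4 / 7) q (3 / 5) (1 / 100) x i' y)) *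
      ((!![1, √(3 / 7), 0; √(3 / 7), 1, 0; 0, 0, 1] : Matrix (Fin 3) (Fin 3) ℝ)
        (nextState i y) (nextState i' y) *
      (!![1, ![1, √(3 / 7) / (√(1 - q) * √(99 / 100)), √(3 / 7)] x, 0;
        ![1, √(3 / 7) / (√(1 - q) * √(99 / 100)), √(3 / 7)] x, 1, 0; 0, 0, 1] :
        Matrix (Fin 3) (Fin 3) ℝ) i i') := by
  by_cases hii : i = i'
  · subst hii
    have h := outputProb_sum 0 0 (4 / 7) q (3 / 5) (1 / 100) x i
    have hg : ∀ (g : ℝ) (k : Fin 3),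
        (!![1, g, 0; g, 1, 0; 0, 0, 1] : Matrix (Fin 3) (Fin 3) ℝ) k k = 1 := by
      intro g k
      fin_cases k <;> rfl
    simp only [hg, mul_one]
    exact h.symm.trans <| Finset.sum_congr rfl fun y _ =>
      (Real.mul_self_sqrt (outputProb_nonneg hq₀ (by linarith) x i y)).symm
  · have h1 : √(1 - q) ≠ 0 := (Real.sqrt_pos.2 (by linarith)).ne'
    have e1 : (1 - 4 / 7 : ℝ) = 3 / 7 := by norm_num
    have e2 : (1 - 1 / 100 : ℝ) = 99 / 100 := by norm_num
    rw [Fin.sum_univ_three]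
    fin_cases x <;> fin_cases i <;> fin_cases i' <;> first
      | exact absurd rfl hii
      | (simp [outputProb, nextState, -one_div, e1, e2]; done)
      | (simp [outputProb, nextState, -one_div, e1, e2]; field_simp)

theorem exists_quantumModel_optimal {q : ℝ} (hq₀ : 0 ≤ q) (hq₁ : q ≤ 54 / 100) :
    ∃ M : QuantumModel (investorTransitions 0 0 (4 / 7) q (3 / 5) (1 / 100)),
      star (M.state 0) ⬝ᵥ M.state 1 = (√(3 / 7) : ℝ) ∧ star (M.state 0) ⬝ᵥ M.state 2 = 0 ∧
      star (M.state 1) ⬝ᵥ M.state 2 = 0 := by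
  let γ : Fin 3 → ℝ := ![1, √(3 / 7) / (√(1 - q) * √(99 / 100)), √(3 / 7)]
  have hc : √(3 / 7 : ℝ) ^ 2 ≤ 1 := by rw [Real.sq_sqrt (by norm_num)]; norm_num
  have hγ : ∀ x, γ x ^ 2 ≤ 1 := by
    intro x
    fin_cases x
    · simp [γ]
    · change (√(3 / 7) / (√(1 - q) * √(99 / 100))) ^ 2 ≤ 1
      rw [div_pow, mul_pow, Real.sq_sqrt (by norm_num), Real.sq_sqrt (by linarith),
        -- The upper limit on `q` matters here: a junk overlap of at most 1 on input 1 requires 3/7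
        -- ≤ (1 − q) · 99/100.
        Real.sq_sqrt (by norm_num), div_le_one (by nlinarith)]
      linarith
    · exact hc
  let s : Fin 3 → Fin 3 → ℂ := overlapTriple √(3 / 7)
  let junk : Fin 3 → Fin 3 → Fin 3 → Fin 3 → ℂ := fun i x _ => overlapTriple (γ x) i
  obtain ⟨U, hU, hev⟩ := exists_unitary_of_gram_eq
    (fun k : Fin 3 × Fin 3 => registerState (s k.1) k.2 (0 : Fin 3)
      (Pi.single (0 : Fin 3) (1 : ℂ)))
    (fun k : Fin 3 × Fin 3 => ∑ y, ∑ j,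
      ((√(investorTransitions 0 0 (4 / 7) q (3 / 5) (1 / 100) k.2 y k.1 j) : ℝ) : ℂ) •
        registerState (s j) k.2 y (junk k.1 k.2 y)) (by
      rintro ⟨i, x⟩ ⟨i', x'⟩
      dsimp only
      rw [star_evolution_dotProduct (investorTransitions_apply _ _ _ _ _ _),
        star_registerState_dotProduct]
      by_cases hx : x = x'
      · subst hx
        simp only [s, junk, star_overlapTriple_dotProduct hc,
          star_overlapTriple_dotProduct (hγ _), and_self, if_true]
        rw [overlap_optimal_consistent hq₀ hq₁ i i' x]
        simp [γ]
      · simp [hx])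
  refine ⟨⟨3, 3, s, fun i => ?_, 0, 0, U, hU, junk, fun i x y => ?_, fun i x => hev (i, x)⟩,
    ?_, ?_, ?_⟩
  · simp only [s, star_overlapTriple_dotProduct hc]
    fin_cases i <;> simp
  · simp only [junk, star_overlapTriple_dotProduct (hγ _)]
    fin_cases i <;> simp
  · exact (star_overlapTriple_dotProduct hc 0 1).trans (by simp)
  · exact (star_overlapTriple_dotProduct hc 0 2).trans (by simp)
  · exact (star_overlapTriple_dotProduct hc 1 2).trans (by simp)

theorem isLeast_complexity {q : ℝ} (hq₀ : 0 ≤ q) (hq₁ : q ≤ 54 / 100) {π : Fin 3 → ℝ}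
    (hπ : ∀ i, 0 ≤ π i) :
    IsLeast (Set.range fun M : QuantumModel
      (investorTransitions 0 0 (4 / 7) q (3 / 5) (1 / 100)) => M.complexity π)
      (overlapEntropy π (3 / 7)) := by
  constructor
  · obtain ⟨M, h01, h02, h12⟩ := exists_quantumModel_optimal hq₀ hq₁
    refine ⟨M, M.complexity_eq_overlapEntropy hπ h02 h12 ?_ (by norm_num)⟩
    rw [h01, Complex.norm_real, Real.norm_eq_abs, sq_abs, Real.sq_sqrt (by norm_num)]
  · rintro _ ⟨M, rfl⟩
    have hT := investorTransitions_apply 0 0 (4 / 7) q (3 / 5) (1 / 100)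
    -- On input 0, f always outputs 1 and u always outputs 0.
    have h02 : star (M.state 0) ⬝ᵥ M.state 2 = 0 := by
      rw [M.overlap_eq hT 0 2 0]
      simp [Fin.sum_univ_three, outputProb]
    -- The only common output on input 0 is 0, which sends e to f and keeps u, so the overlap is a
    -- multiple of ⟨f|u⟩ = 0.
    have h12 : star (M.state 1) ⬝ᵥ M.state 2 = 0 := by
      rw [M.overlap_eq hT 1 2 0]
      simp [Fin.sum_univ_three, outputProb, nextState, h02]
    -- The only common output on input 0 is 1, and it sends both states to e: the overlap is √(3/7)
    -- times a junk overlap.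
    have h01 : ‖star (M.state 0) ⬝ᵥ M.state 1‖ ^ 2 ≤ 3 / 7 := by
      have h := M.overlap_eq hT 0 1 0
      have hj := norm_star_dotProduct_le_one (M.junk_norm 0 0 1) (M.junk_norm 1 0 1)
      have e1 : (1 - 4 / 7 : ℝ) = 3 / 7 := by norm_num
      have h' : star (M.state 0) ⬝ᵥ M.state 1 =
          ((√(3 / 7) : ℝ) : ℂ) * (star (M.junk 0 0 1) ⬝ᵥ M.junk 1 0 1) := by
        rw [h]
        simp [Fin.sum_univ_three, outputProb, nextState, e1, M.state_norm]
      rw [h', norm_mul, Complex.norm_real, Real.norm_eq_abs, mul_pow, sq_abs,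
        Real.sq_sqrt (by norm_num)]
      have : ‖star (M.junk 0 0 1) ⬝ᵥ M.junk 1 0 1‖ ^ 2 ≤ 1 := pow_le_one₀ (norm_nonneg _) hj
      linarith
    dsimp only
    rw [M.complexity_eq_overlapEntropy hπ h02 h12 rfl (by linarith)]
    exact overlapEntropy_antitoneOn (hπ 0) (hπ 1) h01 (by norm_num)

/-! ### Both entropies as functions of the odds of u -/

/-- The entropy of a distribution in which one outcome has odds `w : 1` against the others, whose
conditional entropy is `H`. -/
noncomputable def mixEntropy (w H : ℝ) : ℝ := Real.log (1 + w) + (H - w * Real.log w) / (1 + w)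

/-- The grouping rule for entropy. It serves both sides: `δ` is the share of f classically and the
smaller eigenvalue of the normalised f-e block quantum mechanically. -/
theorem negMulLog_add_eq_mixEntropy {w : ℝ} (hw : 0 < w) (δ : ℝ) :
    Real.negMulLog (w * (1 + w)⁻¹) + (Real.negMulLog ((1 - δ) * (1 + w)⁻¹) +
      Real.negMulLog (δ * (1 + w)⁻¹)) = mixEntropy w (Real.binEntropy δ) := by
  have h : 1 + w ≠ 0 := by positivity
  rw [Real.negMulLog_mul, Real.negMulLog_mul, Real.negMulLog_mul,
    Real.binEntropy_eq_negMulLog_add_negMulLog_one_sub, mixEntropy]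
  have hu : Real.negMulLog (1 + w)⁻¹ = (1 + w)⁻¹ * Real.log (1 + w) := by
    rw [Real.negMulLog, Real.log_inv]
    ring
  have hw' : Real.negMulLog w = -(w * Real.log w) := by rw [Real.negMulLog]; ring
  rw [hu, hw']
  field_simp
  ring

theorem shannonEntropy_ratioDist {r w : ℝ} (hr : 0 < r) (hw : 0 < w) :
    shannonEntropy (ratioDist r w) = mixEntropy w (Real.binEntropy (r / (1 + r))) := by
  rw [← negMulLog_add_eq_mixEntropy hw, shannonEntropy, Fin.sum_univ_three]
  have h1 : ratioDist r w 1 = (1 - r / (1 + r)) * (1 + w)⁻¹ := by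
    simp only [ratioDist, Matrix.cons_val]
    field_simp
    ring
  have h0 : ratioDist r w 0 = r / (1 + r) * (1 + w)⁻¹ := by
    simp only [ratioDist, Matrix.cons_val]
    field_simp
  have h2 : ratioDist r w 2 = w * (1 + w)⁻¹ := rfl
  rw [h0, h1, h2]
  ring

/-- The smaller eigenvalue of a mixture with weights `a` and `1 - a` of two pure states with squared
overlap `3 / 7`. -/
noncomputable def minorEigenvalue (a : ℝ) : ℝ := (1 - √(1 - 16 / 7 * (a * (1 - a)))) / 2

theorem overlapEntropy_ratioDist {r w : ℝ} (hr : 0 < r) (hw : 0 < w) :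
    overlapEntropy (ratioDist r w) (3 / 7) =
      mixEntropy w (Real.binEntropy (minorEigenvalue (r / (1 + r)))) := by
  rw [← negMulLog_add_eq_mixEntropy hw, overlapEntropy]
  have h01 : ratioDist r w 0 + ratioDist r w 1 = (1 + w)⁻¹ := by
    simp only [ratioDist, Matrix.cons_val]
    field_simp
    ring
  have hsq : (1 + w)⁻¹ ^ 2 - 4 * (ratioDist r w 0 * ratioDist r w 1 * (1 - 3 / 7)) =
      (1 + w)⁻¹ ^ 2 * (1 - 16 / 7 * (r / (1 + r) * (1 - r / (1 + r)))) := by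
    simp only [ratioDist, Matrix.cons_val]
    field_simp
    ring
  have h2 : ratioDist r w 2 = w * (1 + w)⁻¹ := rfl
  rw [h01, hsq, Real.sqrt_mul (sq_nonneg _), Real.sqrt_sq (by positivity), h2, minorEigenvalue]
  congr 3 <;> ring

theorem minorEigenvalue_mem_Icc {a lo hi : ℝ} (hlo : lo ≤ 1 / 2)
    (h₁ : 1 - 16 / 7 * (a * (1 - a)) ≤ (1 - 2 * lo) ^ 2)
    (h₂ : (1 - 2 * hi) ^ 2 ≤ 1 - 16 / 7 * (a * (1 - a))) :
    minorEigenvalue a ∈ Set.Icc lo hi := by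
  have e₁ := Real.sqrt_le_iff.2 ⟨show 0 ≤ 1 - 2 * lo by linarith, h₁⟩
  have e₂ := Real.le_sqrt_of_sq_le h₂
  constructor <;> unfold minorEigenvalue <;> linarith

theorem mixEntropy_hasDerivAt {w q : ℝ} (hw : 0 < w) (hq : 0 < q) (H : ℝ) :
    HasDerivAt (fun q => mixEntropy (w * q) H)
      (w * (-Real.log (w * q) - H) / (1 + w * q) ^ 2) q := by
  have hwq : 0 < w * q := mul_pos hw hq
  have hl : HasDerivAt (fun q => w * q) w q := by simpa using (hasDerivAt_id q).const_mul w
  have h1 : HasDerivAt (fun q => 1 + w * q) w q := hl.const_add 1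
  have h := (h1.log (by positivity)).add
    (((hl.mul (hl.log hwq.ne')).const_sub H).div h1 (by positivity))
  refine h.congr_deriv ?_
  have : 1 + w * q ≠ 0 := by positivity
  simp only [Pi.mul_apply]
  field_simp
  ring

/-- If the second entropy grows faster at the right end of an interval (with a safety factor `κ`),
then the difference of the entropies is increasing on the interval. -/
theorem mixEntropy_sub_monotoneOn {w₁ w₂ H₁ H₂ α β κ : ℝ} (hw₁ : 0 < w₁) (hw : w₁ ≤ w₂)
    (hα : 0 < α) (hκ : 1 ≤ κ) (hr : w₁ * κ * (1 + w₂ * β) ^ 2 ≤ w₂ * (1 + w₁ * β) ^ 2)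
    (hB : 0 ≤ -Real.log (w₂ * β) - H₂)
    (hAB : -Real.log (w₁ * β) - H₁ ≤ κ * (-Real.log (w₂ * β) - H₂)) :
    MonotoneOn (fun q => mixEntropy (w₂ * q) H₂ - mixEntropy (w₁ * q) H₁) (Set.Icc α β) := by
  have hw₂ : 0 < w₂ := hw₁.trans_le hw
  have hd : ∀ q, 0 < q → HasDerivAt (fun q => mixEntropy (w₂ * q) H₂ - mixEntropy (w₁ * q) H₁)
      (w₂ * (-Real.log (w₂ * q) - H₂) / (1 + w₂ * q) ^ 2 -
        w₁ * (-Real.log (w₁ * q) - H₁) / (1 + w₁ * q) ^ 2) q := fun q hq =>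
    (mixEntropy_hasDerivAt hw₂ hq H₂).sub (mixEntropy_hasDerivAt hw₁ hq H₁)
  refine monotoneOn_of_deriv_nonneg (convex_Icc α β)
    (fun q hq => (hd q (hα.trans_le hq.1)).continuousAt.continuousWithinAt)
    (fun q hq => ?_) (fun q hq => ?_)
  · rw [interior_Icc] at hq
    exact (hd q (hα.trans hq.1)).differentiableAt.differentiableWithinAt
  · rw [interior_Icc] at hq
    have hq0 : 0 < q := hα.trans hq.1
    have hβ : 0 < β := hq0.trans hq.2
    have hqβ : q ≤ β := hq.2.le
    rw [(hd q hq0).deriv, sub_nonneg, div_le_div_iff₀ (by positivity) (by positivity)]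
    have hlog : Real.log q ≤ Real.log β := Real.log_le_log hq0 hqβ
    rw [Real.log_mul hw₂.ne' hβ.ne'] at hB hAB
    rw [Real.log_mul hw₁.ne' hβ.ne'] at hAB
    rw [Real.log_mul hw₂.ne' hq0.ne', Real.log_mul hw₁.ne' hq0.ne']
    set B := -(Real.log w₂ + Real.log q) - H₂ with hBdef
    set A := -(Real.log w₁ + Real.log q) - H₁ with hAdef
    have hB' : 0 ≤ B := by linarith
    -- Going from β down to q raises `A` and `B` by the same amount log β − log q ≥ 0, so the bound
    -- at β persists because `1 ≤ κ`.
    have hA : A ≤ κ * B := by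
      have := mul_nonneg (sub_nonneg.2 hκ) (sub_nonneg.2 hlog)
      rw [hAdef, hBdef]
      linarith
    -- For w₁ ≤ w₂ the quotient (1 + w₂q)/(1 + w₁q) increases with q, so β is the worst case.
    have hratio : (1 + w₂ * q) * (1 + w₁ * β) ≤ (1 + w₂ * β) * (1 + w₁ * q) := by
      have := mul_nonneg (sub_nonneg.2 hw) (sub_nonneg.2 hqβ)
      linarith
    have hr' : w₁ * κ * (1 + w₂ * q) ^ 2 ≤ w₂ * (1 + w₁ * q) ^ 2 := by
      have h1 : ((1 + w₂ * q) * (1 + w₁ * β)) ^ 2 ≤ ((1 + w₂ * β) * (1 + w₁ * q)) ^ 2 :=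
        pow_le_pow_left₀ (by positivity) hratio 2
      have hp : 0 < (1 + w₁ * β) ^ 2 := by positivity
      refine le_of_mul_le_mul_right ?_ hp
      calc w₁ * κ * (1 + w₂ * q) ^ 2 * (1 + w₁ * β) ^ 2
          = w₁ * κ * ((1 + w₂ * q) * (1 + w₁ * β)) ^ 2 := by ring
        _ ≤ w₁ * κ * ((1 + w₂ * β) * (1 + w₁ * q)) ^ 2 := by gcongr
        _ = w₁ * κ * (1 + w₂ * β) ^ 2 * (1 + w₁ * q) ^ 2 := by ring
        _ ≤ w₂ * (1 + w₁ * β) ^ 2 * (1 + w₁ * q) ^ 2 := by gcongr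
        _ = w₂ * (1 + w₁ * q) ^ 2 * (1 + w₁ * β) ^ 2 := by ring
    calc w₁ * A * (1 + w₂ * q) ^ 2 ≤ w₁ * (κ * B) * (1 + w₂ * q) ^ 2 := by gcongr
      _ = w₁ * κ * (1 + w₂ * q) ^ 2 * B := by ring
      _ ≤ w₂ * (1 + w₁ * q) ^ 2 * B := by gcongr
      _ = w₂ * B * (1 + w₁ * q) ^ 2 := by ring

/-! ### Rational enclosures of logarithms and entropies -/

theorem mixEntropy_le {w H h l u : ℝ} (hw : 0 < w) (hH : H ≤ h) (hl : l ≤ Real.log w)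
    (hu : Real.log (1 + w) ≤ u) : mixEntropy w H ≤ u + (h - w * l) / (1 + w) := by
  unfold mixEntropy
  gcongr

theorem le_mixEntropy {w H h l u : ℝ} (hw : 0 < w) (hH : h ≤ H) (hl : Real.log w ≤ l)
    (hu : u ≤ Real.log (1 + w)) : u + (h - w * l) / (1 + w) ≤ mixEntropy w H := by
  unfold mixEntropy
  gcongr

/-- Six terms of the series log((1 + y)/(1 − y)) = 2(y + y³/3 + …) with a remainder bound. In use,
2ᵏ scales `x` into [1, 2), which makes y = (2ᵏx − 1)/(2ᵏx + 1) less than 1/3. -/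
theorem log_mem_Icc {x y l u : ℝ} (k : ℕ) (hy₀ : 0 ≤ y) (hy₁ : y < 1)
    (hx : x * 2 ^ k * (1 - y) = 1 + y)
    (hl : l ≤ 2 * (y + y ^ 3 / 3 + y ^ 5 / 5 + y ^ 7 / 7 + y ^ 9 / 9 + y ^ 11 / 11) -
      k * 0.6931471808)
    (hu : 2 * (y + y ^ 3 / 3 + y ^ 5 / 5 + y ^ 7 / 7 + y ^ 9 / 9 + y ^ 11 / 11 +
      y ^ 13 / (1 - y ^ 2)) - k * 0.6931471803 ≤ u) :
    Real.log x ∈ Set.Icc l u := by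
  have hy : 0 < 1 - y := by linarith
  have hX : x * 2 ^ k = (1 + y) / (1 - y) := by
    rw [eq_div_iff hy.ne', hx]
  have hx0 : x ≠ 0 := by
    rintro rfl
    simp at hx
    linarith
  have hlog : Real.log x = Real.log ((1 + y) / (1 - y)) - k * Real.log 2 := by
    rw [← hX, Real.log_mul hx0 (by positivity), Real.log_pow]
    ring
  have h1 := Real.sum_range_le_log_div hy₀ hy₁ 6
  have h2 := Real.log_div_le_sum_range_add hy₀ hy₁ 6
  simp only [Finset.sum_range_succ, Finset.sum_range_zero] at h1 h2
  norm_num at h1 h2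
  have hk : (0 : ℝ) ≤ k := Nat.cast_nonneg k
  have h3 := mul_le_mul_of_nonneg_left Real.log_two_gt_d9.le hk
  have h4 := mul_le_mul_of_nonneg_left Real.log_two_lt_d9.le hk
  rw [hlog]
  constructor <;> linarith

theorem binEntropy_mem_Icc {a la ua lb ub : ℝ} (ha₀ : 0 ≤ a) (ha₁ : a ≤ 1)
    (ha : Real.log a ∈ Set.Icc la ua) (hb : Real.log (1 - a) ∈ Set.Icc lb ub) :
    Real.binEntropy a ∈ Set.Icc (-(a * ua) - (1 - a) * ub) (-(a * la) - (1 - a) * lb) := by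
  rw [Real.binEntropy_eq_negMulLog_add_negMulLog_one_sub, Real.negMulLog, Real.negMulLog]
  have hb' : 0 ≤ 1 - a := sub_nonneg.2 ha₁
  have h1 := mul_le_mul_of_nonneg_left ha.1 ha₀
  have h2 := mul_le_mul_of_nonneg_left ha.2 ha₀
  have h3 := mul_le_mul_of_nonneg_left hb.1 hb'
  have h4 := mul_le_mul_of_nonneg_left hb.2 hb'
  constructor <;> linarith

theorem binEntropy_mem_Icc_of_mem_Icc {δ lo hi l u l' u' : ℝ} (hlo : 0 ≤ lo) (hhi : hi ≤ 1 / 2)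
    (hδ : δ ∈ Set.Icc lo hi) (hl : Real.binEntropy lo ∈ Set.Icc l u')
    (hu : Real.binEntropy hi ∈ Set.Icc l' u) : Real.binEntropy δ ∈ Set.Icc l u := by
  have hm := Real.binEntropy_strictMonoOn.monotoneOn
  have h2 : (2 : ℝ)⁻¹ = 1 / 2 := by norm_num
  rw [h2] at hm
  have hδ' : δ ∈ Set.Icc (0 : ℝ) (1 / 2) := ⟨hlo.trans hδ.1, hδ.2.trans hhi⟩
  exact ⟨hl.1.trans (hm ⟨hlo, hδ.1.trans hδ'.2⟩ hδ' hδ.1),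
    (hm hδ' ⟨hδ'.1.trans hδ.2, hhi⟩ hδ.2).trans hu.2⟩

/-! ### Closed forms of the two complexities -/

/-- From here on `w` is the coefficient of q₁ in the odds of u: it depends on the input only, and q₁
enters solely through `w * q`. -/
theorem aqProcess_isStatisticalComplexity {q r w a b c : ℝ} (hq₀ : 0 < q) (hq₁ : q ≤ 1)
    (hr : 0 < r) (hw : 0 < w) (habc : a + b + c = 1) (hab : a + 2 / 5 * b < 1)
    (hr' : r = 4 / 7 * a + 1 / 100 * b)
    (hw' : (1 - a - 2 / 5 * b) * (w * (1 + r)) = r * b) :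
    (aqProcess q hq₀.le hq₁).IsStatisticalComplexity ![a, b, c]
      (mixEntropy (w * q) (Real.binEntropy (r / (1 + r)))) :=
  ⟨3, causalState, _, ratioDist r (w * q), aqProcess_isEpsilonTransducer _ _,
    isTheStationaryDistribution_ratioDist hr (by positivity) habc hab hr'
      (by linear_combination q * hw'), (shannonEntropy_ratioDist hr (by positivity)).symm⟩

theorem aqProcess_isOptimalQuantumComplexity {q r w a b c : ℝ} (hq₀ : 0 < q)
    (hq₁ : q ≤ 54 / 100) (hr : 0 < r) (hw : 0 < w) (habc : a + b + c = 1)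
    (hab : a + 2 / 5 * b < 1) (hr' : r = 4 / 7 * a + 1 / 100 * b)
    (hw' : (1 - a - 2 / 5 * b) * (w * (1 + r)) = r * b) :
    (aqProcess q hq₀.le (hq₁.trans (by norm_num))).IsOptimalQuantumComplexity ![a, b, c]
      (mixEntropy (w * q) (Real.binEntropy (minorEigenvalue (r / (1 + r))))) := by
  have hst := isTheStationaryDistribution_ratioDist hr (mul_pos hw hq₀) habc hab hr'
    (q := q) (by linear_combination q * hw')
  refine ⟨3, causalState, _, ratioDist r (w * q), aqProcess_isEpsilonTransducer _ _, hst, ?_⟩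
  rw [← overlapEntropy_ratioDist hr (by positivity)]
  exact isLeast_complexity hq₀.le hq₁ (((hst _).2 rfl).1.1)

/-! ### Numerical entropies for the four inputs -/

theorem binEntropy_two_one_seven : Real.binEntropy (807 / 7807) ∈ Set.Icc (1662111 / 5000000 : ℝ) (1662113 / 5000000) := by
  have h₁ : Real.log (807 / 7807) ∈ Set.Icc (-5673631 / 2500000 : ℝ) (-22694523 / 10000000) :=
    log_mem_Icc 4 (y := 5105 / 20719)
      (by norm_num) (by norm_num) (by norm_num) (by norm_num) (by norm_num)
  have h₂ : Real.log (1 - 807 / 7807) ∈ Set.Icc (-1091107 / 10000000 : ℝ) (-34097 / 312500) :=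
    log_mem_Icc 1 (y := 6193 / 21807)
      (by norm_num) (by norm_num) (by norm_num) (by norm_num) (by norm_num)
  refine Set.Icc_subset_Icc ?_ ?_ (binEntropy_mem_Icc ?_ ?_ h₁ h₂) <;> norm_num

theorem binEntropy_minorEigenvalue_two_one_seven :
    Real.binEntropy (minorEigenvalue (807 / 7807)) ∈ Set.Icc (432253 / 2000000 : ℝ) (2161301 / 10000000) := by
  -- The eigenvalue is enclosed between rationals by squaring; monotonicity of `binEntropy` below
  -- 1/2 then leaves only its values at the two ends.
  have hδ : minorEigenvalue (807 / 7807) ∈ Set.Icc (5611 / 100000 : ℝ) (56111 / 1000000) := by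
    refine minorEigenvalue_mem_Icc ?_ ?_ ?_ <;> norm_num
  have h₁ : Real.log (5611 / 100000) ∈ Set.Icc (-28804413 / 10000000 : ℝ) (-2880441 / 1000000) :=
    log_mem_Icc 5 (y := 1243 / 4368)
      (by norm_num) (by norm_num) (by norm_num) (by norm_num) (by norm_num)
  have h₂ : Real.log (1 - 5611 / 100000) ∈ Set.Icc (-577457 / 10000000 : ℝ) (-577451 / 10000000) :=
    log_mem_Icc 1 (y := 44389 / 144389)
      (by norm_num) (by norm_num) (by norm_num) (by norm_num) (by norm_num)
  have h₃ : Real.log (56111 / 1000000) ∈ Set.Icc (-5760847 / 2000000 : ℝ) (-3600529 / 1250000) :=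
    log_mem_Icc 5 (y := 24861 / 87361)
      (by norm_num) (by norm_num) (by norm_num) (by norm_num) (by norm_num)
  have h₄ : Real.log (1 - 56111 / 1000000) ∈ Set.Icc (-144367 / 2500000 : ℝ) (-288731 / 5000000) :=
    log_mem_Icc 1 (y := 443889 / 1443889)
      (by norm_num) (by norm_num) (by norm_num) (by norm_num) (by norm_num)
  refine Set.Icc_subset_Icc ?_ ?_ (binEntropy_mem_Icc_of_mem_Icc ?_ ?_ hδ
    (binEntropy_mem_Icc ?_ ?_ h₁ h₂) (binEntropy_mem_Icc ?_ ?_ h₃ h₄)) <;> norm_num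

theorem binEntropy_one_seven_two : Real.binEntropy (449 / 7449) ∈ Set.Icc (2277273 / 10000000 : ℝ) (2277279 / 10000000) := by
  have h₁ : Real.log (449 / 7449) ∈ Set.Icc (-28088123 / 10000000 : ℝ) (-5617623 / 2000000) :=
    log_mem_Icc 5 (y := 6919 / 21817)
      (by norm_num) (by norm_num) (by norm_num) (by norm_num) (by norm_num)
  have h₂ : Real.log (1 - 449 / 7449) ∈ Set.Icc (-621697 / 10000000 : ℝ) (-155423 / 2500000) :=
    log_mem_Icc 1 (y := 6551 / 21449)
      (by norm_num) (by norm_num) (by norm_num) (by norm_num) (by norm_num)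
  refine Set.Icc_subset_Icc ?_ ?_ (binEntropy_mem_Icc ?_ ?_ h₁ h₂) <;> norm_num

theorem binEntropy_minorEigenvalue_one_seven_two :
    Real.binEntropy (minorEigenvalue (449 / 7449)) ∈ Set.Icc (1466677 / 10000000 : ℝ) (9167 / 62500) := by
  have hδ : minorEigenvalue (449 / 7449) ∈ Set.Icc (33489 / 1000000 : ℝ) (3349 / 100000) := by
    refine minorEigenvalue_mem_Icc ?_ ?_ ?_ <;> norm_num
  have h₁ : Real.log (33489 / 1000000) ∈ Set.Icc (-33965383 / 10000000 : ℝ) (-16982691 / 5000000) :=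
    log_mem_Icc 5 (y := 2239 / 64739)
      (by norm_num) (by norm_num) (by norm_num) (by norm_num) (by norm_num)
  have h₂ : Real.log (1 - 33489 / 1000000) ∈ Set.Icc (-340627 / 10000000 : ℝ) (-170309 / 5000000) :=
    log_mem_Icc 1 (y := 466511 / 1466511)
      (by norm_num) (by norm_num) (by norm_num) (by norm_num) (by norm_num)
  have h₃ : Real.log (3349 / 100000) ∈ Set.Icc (-8491271 / 2500000 : ℝ) (-33965083 / 10000000) :=
    log_mem_Icc 5 (y := 112 / 3237)
      (by norm_num) (by norm_num) (by norm_num) (by norm_num) (by norm_num)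
  have h₄ : Real.log (1 - 3349 / 100000) ∈ Set.Icc (-340637 / 10000000 : ℝ) (-340629 / 10000000) :=
    log_mem_Icc 1 (y := 46651 / 146651)
      (by norm_num) (by norm_num) (by norm_num) (by norm_num) (by norm_num)
  refine Set.Icc_subset_Icc ?_ ?_ (binEntropy_mem_Icc_of_mem_Icc ?_ ?_ hδ
    (binEntropy_mem_Icc ?_ ?_ h₁ h₂) (binEntropy_mem_Icc ?_ ?_ h₃ h₄)) <;> norm_num

theorem binEntropy_eighteen_one_one : Real.binEntropy (7207 / 21207) ∈ Set.Icc (400581 / 625000 : ℝ) (3204649 / 5000000) := by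
  have h₁ : Real.log (7207 / 21207) ∈ Set.Icc (-5396393 / 5000000 : ℝ) (-2158557 / 2000000) :=
    log_mem_Icc 2 (y := 7621 / 50035)
      (by norm_num) (by norm_num) (by norm_num) (by norm_num) (by norm_num)
  have h₂ : Real.log (1 - 7207 / 21207) ∈ Set.Icc (-207637 / 500000 : ℝ) (-4152739 / 10000000) :=
    log_mem_Icc 1 (y := 6793 / 49207)
      (by norm_num) (by norm_num) (by norm_num) (by norm_num) (by norm_num)
  refine Set.Icc_subset_Icc ?_ ?_ (binEntropy_mem_Icc ?_ ?_ h₁ h₂) <;> norm_num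

theorem binEntropy_minorEigenvalue_eighteen_one_one :
    Real.binEntropy (minorEigenvalue (7207 / 21207)) ∈ Set.Icc (1061099 / 2500000 : ℝ) (66319 / 156250) := by
  have hδ : minorEigenvalue (7207 / 21207) ∈ Set.Icc (151 / 1000 : ℝ) (151001 / 1000000) := by
    refine minorEigenvalue_mem_Icc ?_ ?_ ?_ <;> norm_num
  have h₁ : Real.log (151 / 1000) ∈ Set.Icc (-3780951 / 2000000 : ℝ) (-9452377 / 5000000) :=
    log_mem_Icc 3 (y := 13 / 138)
      (by norm_num) (by norm_num) (by norm_num) (by norm_num) (by norm_num)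
  have h₂ : Real.log (1 - 151 / 1000) ∈ Set.Icc (-1636961 / 10000000 : ℝ) (-10231 / 62500) :=
    log_mem_Icc 1 (y := 349 / 1349)
      (by norm_num) (by norm_num) (by norm_num) (by norm_num) (by norm_num)
  have h₃ : Real.log (151001 / 1000000) ∈ Set.Icc (-18904689 / 10000000 : ℝ) (-1181543 / 625000) :=
    log_mem_Icc 3 (y := 26001 / 276001)
      (by norm_num) (by norm_num) (by norm_num) (by norm_num) (by norm_num)
  have h₄ : Real.log (1 - 151001 / 1000000) ∈ Set.Icc (-1636973 / 10000000 : ℝ) (-409243 / 2500000) :=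
    log_mem_Icc 1 (y := 348999 / 1348999)
      (by norm_num) (by norm_num) (by norm_num) (by norm_num) (by norm_num)
  refine Set.Icc_subset_Icc ?_ ?_ (binEntropy_mem_Icc_of_mem_Icc ?_ ?_ hδ
    (binEntropy_mem_Icc ?_ ?_ h₁ h₂) (binEntropy_mem_Icc ?_ ?_ h₃ h₄)) <;> norm_num

theorem binEntropy_half_half : Real.binEntropy (407 / 1807) ∈ Set.Icc (333409 / 625000 : ℝ) (5334547 / 10000000) := by
  have h₁ : Real.log (407 / 1807) ∈ Set.Icc (-7453051 / 5000000 : ℝ) (-14906099 / 10000000) :=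
    log_mem_Icc 3 (y := 1449 / 5063)
      (by norm_num) (by norm_num) (by norm_num) (by norm_num) (by norm_num)
  have h₂ : Real.log (1 - 407 / 1807) ∈ Set.Icc (-1275979 / 5000000 : ℝ) (-2551957 / 10000000) :=
    log_mem_Icc 1 (y := 993 / 4607)
      (by norm_num) (by norm_num) (by norm_num) (by norm_num) (by norm_num)
  refine Set.Icc_subset_Icc ?_ ?_ (binEntropy_mem_Icc ?_ ?_ h₁ h₂) <;> norm_num

theorem binEntropy_minorEigenvalue_half_half :
    Real.binEntropy (minorEigenvalue (407 / 1807)) ∈ Set.Icc (1756857 / 5000000 : ℝ) (1756869 / 5000000) := by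
  have hδ : minorEigenvalue (407 / 1807) ∈ Set.Icc (7021 / 62500 : ℝ) (112337 / 1000000) := by
    refine minorEigenvalue_mem_Icc ?_ ?_ ?_ <;> norm_num
  have h₁ : Real.log (7021 / 62500) ∈ Set.Icc (-2186261 / 1000000 : ℝ) (-21862607 / 10000000) :=
    log_mem_Icc 4 (y := 12459 / 43709)
      (by norm_num) (by norm_num) (by norm_num) (by norm_num) (by norm_num)
  have h₂ : Real.log (1 - 7021 / 62500) ∈ Set.Icc (-59581 / 500000 : ℝ) (-595809 / 5000000) :=
    log_mem_Icc 1 (y := 24229 / 86729)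
      (by norm_num) (by norm_num) (by norm_num) (by norm_num) (by norm_num)
  have h₃ : Real.log (112337 / 1000000) ∈ Set.Icc (-21862521 / 10000000 : ℝ) (-10931259 / 5000000) :=
    log_mem_Icc 4 (y := 49837 / 174837)
      (by norm_num) (by norm_num) (by norm_num) (by norm_num) (by norm_num)
  have h₄ : Real.log (1 - 112337 / 1000000) ∈ Set.Icc (-74477 / 625000 : ℝ) (-1191629 / 10000000) :=
    log_mem_Icc 1 (y := 387663 / 1387663)
      (by norm_num) (by norm_num) (by norm_num) (by norm_num) (by norm_num)
  refine Set.Icc_subset_Icc ?_ ?_ (binEntropy_mem_Icc_of_mem_Icc ?_ ?_ hδ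
    (binEntropy_mem_Icc ?_ ?_ h₁ h₂) (binEntropy_mem_Icc ?_ ?_ h₃ h₄)) <;> norm_num

/-! ### The ambiguous ordering on intervals of q₁ -/

/-- The differences C₂ − C₁ and Q₂ − Q₁ both increase with q₁. So C₂ < C₁ is hardest at 54/100,
where `hC` gives it, and Q₁ < Q₂ is hardest at `α`, where `hQ` gives it. -/
theorem aqProcess_ambiguousOrdering {α κ q r₁ w₁ a₁ b₁ c₁ r₂ w₂ a₂ b₂ c₂ : ℝ}
    (hq : q ∈ Set.Icc α (54 / 100)) (hα : 0 < α) (hr₁ : 0 < r₁) (hr₂ : 0 < r₂) (hw₁ : 0 < w₁)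
    (hw : w₁ ≤ w₂) (hκ : 1 ≤ κ)
    (hrat : w₁ * κ * (1 + w₂ * (54 / 100)) ^ 2 ≤ w₂ * (1 + w₁ * (54 / 100)) ^ 2)
    (habc₁ : a₁ + b₁ + c₁ = 1) (hab₁ : a₁ + 2 / 5 * b₁ < 1)
    (hr₁' : r₁ = 4 / 7 * a₁ + 1 / 100 * b₁)
    (hw₁' : (1 - a₁ - 2 / 5 * b₁) * (w₁ * (1 + r₁)) = r₁ * b₁)
    (habc₂ : a₂ + b₂ + c₂ = 1) (hab₂ : a₂ + 2 / 5 * b₂ < 1)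
    (hr₂' : r₂ = 4 / 7 * a₂ + 1 / 100 * b₂)
    (hw₂' : (1 - a₂ - 2 / 5 * b₂) * (w₂ * (1 + r₂)) = r₂ * b₂)
    (hC₀ : 0 ≤ -Real.log (w₂ * (54 / 100)) - Real.binEntropy (r₂ / (1 + r₂)))
    (hC₁ : -Real.log (w₁ * (54 / 100)) - Real.binEntropy (r₁ / (1 + r₁)) ≤
      κ * (-Real.log (w₂ * (54 / 100)) - Real.binEntropy (r₂ / (1 + r₂))))
    (hQ₀ : 0 ≤ -Real.log (w₂ * (54 / 100)) -
      Real.binEntropy (minorEigenvalue (r₂ / (1 + r₂))))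
    (hQ₁ : -Real.log (w₁ * (54 / 100)) - Real.binEntropy (minorEigenvalue (r₁ / (1 + r₁))) ≤
      κ * (-Real.log (w₂ * (54 / 100)) - Real.binEntropy (minorEigenvalue (r₂ / (1 + r₂)))))
    (hC : mixEntropy (w₂ * (54 / 100)) (Real.binEntropy (r₂ / (1 + r₂))) <
      mixEntropy (w₁ * (54 / 100)) (Real.binEntropy (r₁ / (1 + r₁))))
    (hQ : mixEntropy (w₁ * α) (Real.binEntropy (minorEigenvalue (r₁ / (1 + r₁)))) <
      mixEntropy (w₂ * α) (Real.binEntropy (minorEigenvalue (r₂ / (1 + r₂))))) :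
    (aqProcess q (hα.le.trans hq.1) (hq.2.trans (by norm_num))).AmbiguousOrdering
      ![a₁, b₁, c₁] ![a₂, b₂, c₂] := by
  have hq₀ : 0 < q := hα.trans_le hq.1
  have hq₁ : q ≤ 1 := hq.2.trans (by norm_num)
  have hw₂ : 0 < w₂ := hw₁.trans_le hw
  have hαβ : α ≤ 54 / 100 := hq.1.trans hq.2
  have hmC := mixEntropy_sub_monotoneOn hw₁ hw hα hκ hrat hC₀ hC₁ hq
    (Set.right_mem_Icc.2 hαβ) hq.2
  have hmQ := mixEntropy_sub_monotoneOn hw₁ hw hα hκ hrat hQ₀ hQ₁ (Set.left_mem_Icc.2 hαβ)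
    hq hq.1
  simp only at hmC hmQ
  exact ⟨_, _, _, _,
    aqProcess_isStatisticalComplexity hq₀ hq₁ hr₁ hw₁ habc₁ hab₁ hr₁' hw₁',
    aqProcess_isStatisticalComplexity hq₀ hq₁ hr₂ hw₂ habc₂ hab₂ hr₂' hw₂',
    aqProcess_isOptimalQuantumComplexity hq₀ hq.2 hr₁ hw₁ habc₁ hab₁ hr₁' hw₁',
    aqProcess_isOptimalQuantumComplexity hq₀ hq.2 hr₂ hw₂ habc₂ hab₂ hr₂' hw₂',
    by linarith, by linarith⟩

theorem ambiguousOrdering_two_one_seven {q : ℝ}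
    (hq : q ∈ Set.Icc (30 / 100 : ℝ) (54 / 100)) :
    (aqProcess q (hq.1.trans' (by norm_num)) (hq.2.trans (by norm_num))).AmbiguousOrdering
      ![2 / 10, 1 / 10, 7 / 10] ![1 / 10, 7 / 10, 2 / 10] := by
  have ha₁ : (807 / 7000 : ℝ) / (1 + 807 / 7000) = 807 / 7807 := by norm_num
  have hH₁ := binEntropy_two_one_seven
  have hD₁ := binEntropy_minorEigenvalue_two_one_seven
  have lβ₁ : Real.log (4035 / 296666 * (54 / 100)) ∈ Set.Icc (-49137869 / 10000000 : ℝ) (-49137863 / 10000000) :=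
    log_mem_Icc 8 (y := 652831 / 2136161)
      (by norm_num) (by norm_num) (by norm_num) (by norm_num) (by norm_num)
  have mβ₁ : Real.log (1 + 4035 / 296666 * (54 / 100)) ∈ Set.Icc (73177 / 10000000 : ℝ) (36589 / 5000000) :=
    log_mem_Icc 0 (y := 21789 / 5955109)
      (by norm_num) (by norm_num) (by norm_num) (by norm_num) (by norm_num)
  have lα₁ : Real.log (4035 / 296666 * (30 / 100)) ∈ Set.Icc (-11003147 / 2000000 : ℝ) (-27507867 / 5000000) :=
    log_mem_Icc 8 (y := 6611 / 303277)
      (by norm_num) (by norm_num) (by norm_num) (by norm_num) (by norm_num)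
  have mα₁ : Real.log (1 + 4035 / 296666 * (30 / 100)) ∈ Set.Icc (509 / 125000 : ℝ) (40721 / 10000000) :=
    log_mem_Icc 0 (y := 2421 / 1189085)
      (by norm_num) (by norm_num) (by norm_num) (by norm_num) (by norm_num)
  have ha₂ : (449 / 7000 : ℝ) / (1 + 449 / 7000) = 449 / 7449 := by norm_num
  have hH₂ := binEntropy_one_seven_two
  have hD₂ := binEntropy_minorEigenvalue_one_seven_two
  have lβ₂ : Real.log (15715 / 230919 * (54 / 100)) ∈ Set.Icc (-264291 / 80000 : ℝ) (-16518187 / 5000000) :=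
    log_mem_Icc 5 (y := 67727 / 837457)
      (by norm_num) (by norm_num) (by norm_num) (by norm_num) (by norm_num)
  have mβ₂ : Real.log (1 + 15715 / 230919 * (54 / 100)) ∈ Set.Icc (3609 / 100000 : ℝ) (360901 / 10000000) :=
    log_mem_Icc 0 (y := 28287 / 1567747)
      (by norm_num) (by norm_num) (by norm_num) (by norm_num) (by norm_num)
  have lα₂ : Real.log (15715 / 230919 * (30 / 100)) ∈ Set.Icc (-19457121 / 5000000 : ℝ) (-38914241 / 10000000) :=
    log_mem_Icc 6 (y := 23603 / 177549)
      (by norm_num) (by norm_num) (by norm_num) (by norm_num) (by norm_num)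
  have mα₂ : Real.log (1 + 15715 / 230919 * (30 / 100)) ∈ Set.Icc (101053 / 5000000 : ℝ) (202107 / 10000000) :=
    log_mem_Icc 0 (y := 3143 / 311035)
      (by norm_num) (by norm_num) (by norm_num) (by norm_num) (by norm_num)
  -- Any κ between about 1.49 (from the logarithmic factors at 54/100) and about 4.7 (from `hrat`)
  -- would serve.
  refine aqProcess_ambiguousOrdering (κ := 2) (r₁ := 807 / 7000) (w₁ := 4035 / 296666) (r₂ := 449 / 7000)
    (w₂ := 15715 / 230919) (α := 30 / 100) hq (by norm_num) (by norm_num) (by norm_num) (by norm_num)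
    (by norm_num) (by norm_num) (by norm_num) (by norm_num) (by norm_num) (by norm_num)
    (by norm_num) (by norm_num) (by norm_num) (by norm_num) (by norm_num) ?_ ?_ ?_ ?_ ?_ ?_
  · rw [ha₂]
    linarith [lβ₂.2, hH₂.2]
  · rw [ha₁, ha₂]
    linarith [lβ₁.1, hH₁.1, lβ₂.2, hH₂.2]
  · rw [ha₂]
    linarith [lβ₂.2, hD₂.2]
  · rw [ha₁, ha₂]
    linarith [lβ₁.1, hD₁.1, lβ₂.2, hD₂.2]
  · rw [ha₁, ha₂]
    refine (mixEntropy_le (by norm_num) hH₂.2 lβ₂.1 mβ₂.2).trans_lt (lt_of_lt_of_le ?_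
      (le_mixEntropy (by norm_num) hH₁.1 lβ₁.2 mβ₁.1))
    norm_num
  · rw [ha₁, ha₂]
    refine (mixEntropy_le (by norm_num) hD₁.2 lα₁.1 mα₁.2).trans_lt (lt_of_lt_of_le ?_
      (le_mixEntropy (by norm_num) hD₂.1 lα₂.2 mα₂.1))
    norm_num

theorem ambiguousOrdering_eighteen_one_one {q : ℝ}
    (hq : q ∈ Set.Icc (22 / 100 : ℝ) (54 / 100)) :
    (aqProcess q (hq.1.trans' (by norm_num)) (hq.2.trans (by norm_num))).AmbiguousOrdering
      ![9 / 10, 1 / 20, 1 / 20] ![1 / 2, 1 / 2, 0] := by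
  have ha₁ : (7207 / 14000 : ℝ) / (1 + 7207 / 14000) = 7207 / 21207 := by norm_num
  have hH₁ := binEntropy_eighteen_one_one
  have hD₁ := binEntropy_minorEigenvalue_eighteen_one_one
  have lβ₁ : Real.log (36035 / 169656 * (54 / 100)) ∈ Set.Icc (-5413671 / 2500000 : ℝ) (-541367 / 250000) :=
    log_mem_Icc 4 (y := 14759 / 50104)
      (by norm_num) (by norm_num) (by norm_num) (by norm_num) (by norm_num)
  have mβ₁ : Real.log (1 + 36035 / 169656 * (54 / 100)) ∈ Set.Icc (1085819 / 10000000 : ℝ) (54291 / 500000) :=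
    log_mem_Icc 0 (y := 64863 / 1195903)
      (by norm_num) (by norm_num) (by norm_num) (by norm_num) (by norm_num)
  have lα₁ : Real.log (36035 / 169656 * (22 / 100)) ∈ Set.Icc (-306341 / 100000 : ℝ) (-15317049 / 5000000) :=
    log_mem_Icc 5 (y := 52519 / 264589)
      (by norm_num) (by norm_num) (by norm_num) (by norm_num) (by norm_num)
  have mα₁ : Real.log (1 + 36035 / 169656 * (22 / 100)) ∈ Set.Icc (456691 / 10000000 : ℝ) (114173 / 2500000) :=
    log_mem_Icc 0 (y := 79277 / 3472397)
      (by norm_num) (by norm_num) (by norm_num) (by norm_num) (by norm_num)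
  have ha₂ : (407 / 1400 : ℝ) / (1 + 407 / 1400) = 407 / 1807 := by norm_num
  have hH₂ := binEntropy_half_half
  have hD₂ := binEntropy_minorEigenvalue_half_half
  have lβ₂ : Real.log (2035 / 5421 * (54 / 100)) ∈ Set.Icc (-15959707 / 10000000 : ℝ) (-7979853 / 5000000) :=
    log_mem_Icc 3 (y := 5617 / 23687)
      (by norm_num) (by norm_num) (by norm_num) (by norm_num) (by norm_num)
  have mβ₂ : Real.log (1 + 2035 / 5421 * (54 / 100)) ∈ Set.Icc (1845787 / 10000000 : ℝ) (461447 / 2500000) :=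
    log_mem_Icc 0 (y := 3663 / 39803)
      (by norm_num) (by norm_num) (by norm_num) (by norm_num) (by norm_num)
  have lα₂ : Real.log (2035 / 5421 * (22 / 100)) ∈ Set.Icc (-24939123 / 10000000 : ℝ) (-12469561 / 5000000) :=
    log_mem_Icc 4 (y := 8711 / 62921)
      (by norm_num) (by norm_num) (by norm_num) (by norm_num) (by norm_num)
  have mα₂ : Real.log (1 + 2035 / 5421 * (22 / 100)) ∈ Set.Icc (99191 / 1250000 : ℝ) (793529 / 10000000) :=
    log_mem_Icc 0 (y := 4477 / 112897)
      (by norm_num) (by norm_num) (by norm_num) (by norm_num) (by norm_num)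
  -- The room for κ is narrow here: roughly from 1.44 to 1.52.
  refine aqProcess_ambiguousOrdering (κ := 3 / 2) (r₁ := 7207 / 14000) (w₁ := 36035 / 169656) (r₂ := 407 / 1400)
    (w₂ := 2035 / 5421) (α := 22 / 100) hq (by norm_num) (by norm_num) (by norm_num) (by norm_num)
    (by norm_num) (by norm_num) (by norm_num) (by norm_num) (by norm_num) (by norm_num)
    (by norm_num) (by norm_num) (by norm_num) (by norm_num) (by norm_num) ?_ ?_ ?_ ?_ ?_ ?_
  · rw [ha₂]
    linarith [lβ₂.2, hH₂.2]
  · rw [ha₁, ha₂]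
    linarith [lβ₁.1, hH₁.1, lβ₂.2, hH₂.2]
  · rw [ha₂]
    linarith [lβ₂.2, hD₂.2]
  · rw [ha₁, ha₂]
    linarith [lβ₁.1, hD₁.1, lβ₂.2, hD₂.2]
  · rw [ha₁, ha₂]
    refine (mixEntropy_le (by norm_num) hH₂.2 lβ₂.1 mβ₂.2).trans_lt (lt_of_lt_of_le ?_
      (le_mixEntropy (by norm_num) hH₁.1 lβ₁.2 mβ₁.1))
    norm_num
  · rw [ha₁, ha₂]
    refine (mixEntropy_le (by norm_num) hD₁.2 lα₁.1 mα₁.2).trans_lt (lt_of_lt_of_le ?_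
      (le_mixEntropy (by norm_num) hD₂.1 lα₂.2 mα₂.1))
    norm_num

theorem mainTheorem9 :
    ∃ I₁ ∈ stdSimplex ℝ (Fin 3), ∃ I₂ ∈ stdSimplex ℝ (Fin 3),
      ∀ q₁ ∈ Set.Icc (22 / 100 : ℝ) (54 / 100),
        ∃ (A : InputOutputProcess (Fin 3) (Fin 3)) (ε : JointPast (Fin 3) (Fin 3) → Fin 3),
          A.IsEpsilonTransducer ε (investorTransitions 0 0 (4 / 7) q₁ (3 / 5) (1 / 100)) ∧
          A.AmbiguousOrdering I₁ I₂ ∧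
          (30 / 100 ≤ q₁ →
            A.AmbiguousOrdering ![2 / 10, 1 / 10, 7 / 10] ![1 / 10, 7 / 10, 2 / 10]) := by
  refine ⟨![9 / 10, 1 / 20, 1 / 20], ?_, ![1 / 2, 1 / 2, 0], ?_, fun q hq =>
    ⟨aqProcess q (hq.1.trans' (by norm_num)) (hq.2.trans (by norm_num)), causalState,
      aqProcess_isEpsilonTransducer _ _, ambiguousOrdering_eighteen_one_one hq,
      fun h => ambiguousOrdering_two_one_seven ⟨h, hq.2⟩⟩⟩
  all_goals
    refine ⟨fun i => ?_, by simp only [Fin.sum_univ_three, Matrix.cons_val]; norm_num⟩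
    fin_cases i <;> norm_num
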